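/- All graphs are finite, simple and undirected. A graph is \emph{bridgeless} if none of its edges is a bridge (an edge whose removal disconnects its two ends). It is \emph{outerplanar} if it can be embedded in the plane (vertices as distinct points, edges as simple polygonal curves joining their ends, which contain no other vertex and meet each other only in common ends) in such a way that all vertices are incident with a common face. An edge coloring (not necessarily proper) of a graph makes it \emph{rainbow connected} if any two vertices are joined by a path whose edges have pairwise distinct colors, and for a connected graph $G$ the \emph{rainbow connection number} $rc(G)$ is the smallest number of colors for which such an edge coloring exists. Theorem. If $G$ is a bridgeless outerplanar graph with diameter three, then $3\le rc(G)\le 6$. -/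

import Mathlib

namespace SimpleGraph

/-- The Euclidean plane. -/
abbrev Plane : Type := EuclideanSpace ℝ (Fin 2)

/-- `S` is a simple polygonal curve with endpoints `x` and `y`: the union of the segments joining
consecutive terms of a finite sequence `p 0 = x, p 1, …, p n = y` of distinct points, where
consecutive segments meet only in their common endpoint and other pairs of segments are
disjoint. The values `p i` for `i > n` play no role. -/
def IsPolygonalArc (x y : Plane) (S : Set Plane) : Prop :=
  ∃ (n : ℕ) (p : ℕ → Plane),
    p 0 = x ∧ p n = y ∧
    (∀ i j, i ≤ n → j ≤ n → p i = p j → i = j) ∧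
    (∀ i j, i < j → j < n → ∀ z ∈ segment ℝ (p i) (p (i + 1)),
      z ∈ segment ℝ (p j) (p (j + 1)) → j = i + 1 ∧ z = p j) ∧
    S = {z | ∃ i, i < n ∧ z ∈ segment ℝ (p i) (p (i + 1))}

variable {V : Type*}

/-- An embedding of a graph in the plane: distinct vertices are sent to distinct points, every edge
to a simple polygonal curve joining the images of its ends; the curve of an edge contains no image
of a vertex other than its ends, and the curves of two edges meet at most in images of common
ends. The values of `curve` outside the edge set play no role. -/
structure PlaneEmbedding (G : SimpleGraph V) where
  /-- The position of each vertex. -/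
  pos : V → Plane
  /-- The curve that represents each edge. -/
  curve : Sym2 V → Set Plane
  pos_injective : Function.Injective pos
  isPolygonalArc_curve : ∀ u v, G.Adj u v → IsPolygonalArc (pos u) (pos v) (curve s(u, v))
  mem_of_pos_mem_curve : ∀ e ∈ G.edgeSet, ∀ w, pos w ∈ curve e → w ∈ e
  curve_inter : ∀ e ∈ G.edgeSet, ∀ f ∈ G.edgeSet, e ≠ f → ∀ z ∈ curve e, z ∈ curve f →
    ∃ w, w ∈ e ∧ w ∈ f ∧ z = pos w

/-- The set of all points of the plane used by an embedding. -/
def PlaneEmbedding.drawing {G : SimpleGraph V} (D : G.PlaneEmbedding) : Set Plane :=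
  Set.range D.pos ∪ ⋃ e ∈ G.edgeSet, D.curve e

/-- A face of an embedding is a connected component of the complement of the drawing. -/
def PlaneEmbedding.IsFace {G : SimpleGraph V} (D : G.PlaneEmbedding) (F : Set Plane) : Prop :=
  ∃ x ∈ D.drawingᶜ, F = connectedComponentIn D.drawingᶜ x

/-- A graph is outerplanar if it can be embedded in the plane in such a way that all vertices are
incident with (that is, lie on the boundary of) a common face. -/
def IsOuterplanar (G : SimpleGraph V) : Prop :=
  ∃ (D : G.PlaneEmbedding) (F : Set Plane), D.IsFace F ∧ ∀ v, D.pos v ∈ frontier F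

/-- A graph is bridgeless if none of its edges is a bridge. -/
def IsBridgeless (G : SimpleGraph V) : Prop :=
  ∀ e ∈ G.edgeSet, ¬ G.IsBridge e

/-- An edge colouring (not necessarily proper) makes `G` rainbow connected if any two vertices are
joined by a path whose edges have pairwise distinct colours. -/
def IsRainbowConnected (G : SimpleGraph V) {K : Type*} (c : G.EdgeLabeling K) : Prop :=
  ∀ u v : V, ∃ p : G.Walk u v, p.IsPath ∧
    ∀ e f : G.edgeSet, (e : Sym2 V) ∈ p.edges → (f : Sym2 V) ∈ p.edges → c e = c f → e = f

/-- The rainbow connection number: the least number of colours with which the edges of `G` can be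
coloured so that `G` becomes rainbow connected (`⊤` if there is no such number). -/
noncomputable def rainbowConnectionNumber (G : SimpleGraph V) : ℕ∞ :=
  ⨅ k ∈ {k : ℕ | ∃ c : G.EdgeLabeling (Fin k), G.IsRainbowConnected c}, (k : ℕ∞)

end SimpleGraph

namespace SimpleGraph

/-! Lower bound: a path with pairwise distinct colours has at most as many edges as there are
colours, so the diameter is a lower bound.

Upper bound: let `D` be a dominating set that is rainbow connected within itself by `k` colours.
Bridgelessness gives every vertex two neighbours, and then three new colours suffice for the rest
(`exists_rainbow_extension`): every vertex has two ways into `D` using disjoint sets of new colours.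
If the ends of some edge dominate, `k = 1`. Otherwise an extremal argument yields a dominating
induced cycle (`IsOuterplanar.exists_dominating_cycle`). The graph retracts onto it, so diameter
three bounds its length by 7, and a cycle of length 7 contains all vertices
(`IsOuterplanar.length_le_seven`). A cycle of length `n` needs `⌈n / 2⌉` colours: at most 3 + 3 if
`n ≤ 6`, and 4 without extension if `n = 7`.

Outerplanarity enters only through `IsOuterplanar.exists_attachSet_subset`: a component outside a
cycle is attached only at the ends of one edge of the cycle. This follows from the absence of theta
graphs with paths of length at least two and of complete graphs on four vertices.

These two exclusions use angles instead of the Jordan curve theorem. For three paths from `u` to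
`v`, the difference of the angle sums along two of them is `2 * π` times a winding number. It keeps
its value from the common face, through the first vertex of the third path, along that path's first
edge up to `u`. The three limits so obtained at `u` add up to zero, which contradicts
`branch_point_sum_ne_zero`. -/

open Filter Topology

/-! ### View angles and their limits at a branch point. -/

/-- The identification of the Euclidean plane with the complex numbers. -/
noncomputable abbrev toComplex : Plane ≃ₗᵢ[ℝ] ℂ := Complex.orthonormalBasisOneI.repr.symm

/-- The oriented angle under which the segment from `a` to `b` is seen from `z`. -/
noncomputable def viewAngle (a b z : Plane) : ℝ :=
  Complex.arg ((toComplex b - toComplex z) / (toComplex a - toComplex z))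

theorem toComplex_sub_ne_zero {a z : Plane} (h : z ≠ a) : toComplex a - toComplex z ≠ 0 := by
  rw [sub_ne_zero]
  exact fun h' => h (toComplex.injective h').symm

/-- Off the ends, the quotient meets the branch cut of `Complex.arg` exactly when `a` and `b` are
seen from `z` in opposite directions, that is, when `z` lies between them. -/
theorem continuousAt_viewAngle {a b z : Plane} (hz : z ∉ segment ℝ a b) :
    ContinuousAt (viewAngle a b) z := by
  have ha : z ≠ a := fun h => hz (h ▸ left_mem_segment ℝ a b)
  have hb : z ≠ b := fun h => hz (h ▸ right_mem_segment ℝ a b)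
  have ha' := toComplex_sub_ne_zero ha
  have hb' := toComplex_sub_ne_zero hb
  have hq : ContinuousAt (fun z : Plane =>
      (toComplex b - toComplex z) / (toComplex a - toComplex z)) z := by
    have hc : ContinuousAt (fun z : Plane => toComplex z) z := toComplex.continuous.continuousAt
    exact (continuousAt_const.sub hc).div (continuousAt_const.sub hc) ha'
  refine ContinuousAt.comp (f := fun z : Plane =>
      (toComplex b - toComplex z) / (toComplex a - toComplex z)) (g := Complex.arg)
    (Complex.continuousAt_arg ?_) hq
  rw [Complex.mem_slitPlane_iff_not_le_zero]
  intro hle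
  obtain ⟨hre, him⟩ := Complex.le_def.1 hle
  set q := (toComplex b - toComplex z) / (toComplex a - toComplex z) with hqdef
  obtain ⟨s, hs, hqs⟩ : ∃ s : ℝ, 0 ≤ s ∧ q = -(s : ℂ) := by
    refine ⟨-q.re, by simpa using hre, ?_⟩
    apply Complex.ext
    · simp
    · simpa using him
  have hmul : toComplex b - toComplex z = -(s : ℂ) * (toComplex a - toComplex z) := by
    rw [← hqs, hqdef, div_mul_cancel₀ _ ha']
  apply hz
  have hs1 : (0 : ℝ) < 1 + s := by linarith
  -- The equation `b - z = -s (a - z)` solved for `z`.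
  refine ⟨s / (1 + s), 1 / (1 + s), by positivity, by positivity, by field_simp; ring, ?_⟩
  apply toComplex.injective
  have hs2 : (1 + s : ℂ) ≠ 0 := by exact_mod_cast hs1.ne'
  simp only [map_add, map_smul, Complex.real_smul]
  push_cast
  field_simp
  linear_combination hmul

theorem coe_viewAngle {a b z : Plane} (ha : z ≠ a) (hb : z ≠ b) :
    (viewAngle a b z : Real.Angle) =
      Complex.arg (toComplex b - toComplex z) - Complex.arg (toComplex a - toComplex z) :=
  Complex.arg_div_coe_angle (toComplex_sub_ne_zero hb) (toComplex_sub_ne_zero ha)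

theorem toComplex_ne_zero {d : Plane} (hd : d ≠ 0) : toComplex d ≠ 0 :=
  fun h => hd (toComplex.map_eq_zero_iff.1 h)

/-- Two nonzero vectors that span different rays. -/
def DistinctRays (d e : Plane) : Prop := ∀ s t : ℝ, 0 < s → 0 < t → s • d ≠ t • e

theorem DistinctRays.symm {d e : Plane} (h : DistinctRays d e) : DistinctRays e d :=
  fun s t hs ht he => h t s ht hs he.symm

theorem DistinctRays.neg_div_mem_slitPlane {d e : Plane} (hd : d ≠ 0) (he : e ≠ 0)
    (h : DistinctRays d e) : -(toComplex d / toComplex e) ∈ Complex.slitPlane := by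
  have he' : toComplex e ≠ 0 := toComplex_ne_zero he
  have hd' : toComplex d ≠ 0 := toComplex_ne_zero hd
  rw [Complex.mem_slitPlane_iff_not_le_zero]
  intro hle
  obtain ⟨hre, him⟩ := Complex.le_def.1 hle
  set q := toComplex d / toComplex e with hq
  have hqr : q = (q.re : ℂ) := by
    apply Complex.ext
    · simp
    · simpa using him
  have hq0 : q ≠ 0 := div_ne_zero hd' he'
  have hpos : 0 < q.re := by
    have h0 : 0 ≤ q.re := by simpa using hre
    refine lt_of_le_of_ne h0 fun h1 => hq0 ?_
    rw [hqr, ← h1]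
    simp
  refine h 1 q.re one_pos hpos ?_
  apply toComplex.injective
  rw [one_smul, map_smul, Complex.real_smul, ← hqr, hq, div_mul_cancel₀ _ he']

theorem tendsto_viewAngle_ray {x d e : Plane} (hd : d ≠ 0) (he : e ≠ 0) (h : DistinctRays d e) :
    Tendsto (fun t : ℝ => viewAngle x (x + d) (x + t • e)) (𝓝[>] 0)
      (𝓝 (Complex.arg (-(toComplex d / toComplex e)))) := by
  have he' : toComplex e ≠ 0 := toComplex_ne_zero he
  have hlim : Tendsto (fun t : ℝ => (toComplex d - (t : ℂ) * toComplex e) / (-toComplex e))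
      (𝓝[>] 0) (𝓝 (-(toComplex d / toComplex e))) := by
    have hc : ContinuousAt
        (fun t : ℝ => (toComplex d - (t : ℂ) * toComplex e) / (-toComplex e)) 0 := by fun_prop
    have := hc.tendsto
    simp only [Complex.ofReal_zero, zero_mul, sub_zero, div_neg] at this
    simp only [div_neg]
    exact this.mono_left nhdsWithin_le_nhds
  refine ((Complex.continuousAt_arg (h.neg_div_mem_slitPlane hd he)).tendsto.comp hlim).congr' ?_
  filter_upwards [self_mem_nhdsWithin] with t ht
  have ht : 0 < t := ht
  have htC : (t : ℂ) ≠ 0 := by exact_mod_cast ht.ne'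
  simp only [Function.comp_apply, viewAngle, map_add, map_smul, Complex.real_smul]
  -- Multiplying by `t > 0` keeps the argument and removes the singularity at `t = 0`.
  rw [← Complex.arg_real_mul ((toComplex x + toComplex d - (toComplex x + t * toComplex e)) /
    (toComplex x - (toComplex x + t * toComplex e))) ht]
  congr 1
  have h1 : toComplex x - (toComplex x + t * toComplex e) = t * (-toComplex e) := by ring
  have h2 : toComplex x + toComplex d - (toComplex x + t * toComplex e)
    = toComplex d - t * toComplex e := by ring
  rw [h1, h2]
  field_simp

theorem arg_neg_div_swap {d e : Plane} (hd : d ≠ 0) (he : e ≠ 0) (h : DistinctRays d e) :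
    Complex.arg (-(toComplex e / toComplex d)) = -Complex.arg (-(toComplex d / toComplex e)) := by
  have h1 : -(toComplex e / toComplex d) = (-(toComplex d / toComplex e))⁻¹ := by
    rw [inv_neg, inv_div]
  rw [h1, Complex.arg_inv, if_neg (Complex.mem_slitPlane_iff_arg.1 (h.neg_div_mem_slitPlane hd he)).1]

/-- Three curves leaving `x` in different directions `d i`: the winding numbers of the three closed
curves formed by two of them around the third never sum to zero. -/
theorem branch_point_sum_ne_zero {x : Plane} {d : Fin 3 → Plane} {A B : Fin 3 → Plane → ℝ}
    (hd : ∀ i, d i ≠ 0) (hne : ∀ i j, i ≠ j → DistinctRays (d i) (d j))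
    (hA : ∀ i z, A i z = viewAngle x (x + d i) z + B i z) (hB : ∀ i, ContinuousAt (B i) x)
    {α β γ : ℝ}
    (hα : Tendsto (fun t : ℝ => A 0 (x + t • d 2) - A 1 (x + t • d 2)) (𝓝[>] 0) (𝓝 α))
    (hβ : Tendsto (fun t : ℝ => A 1 (x + t • d 0) - A 2 (x + t • d 0)) (𝓝[>] 0) (𝓝 β))
    (hγ : Tendsto (fun t : ℝ => A 2 (x + t • d 1) - A 0 (x + t • d 1)) (𝓝[>] 0) (𝓝 γ)) :
    α + β + γ ≠ 0 := by
  set θ : Fin 3 → Fin 3 → ℝ := fun i j => Complex.arg (-(toComplex (d i) / toComplex (d j)))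
    with hθ
  have hlimB : ∀ i j, Tendsto (fun t : ℝ => B i (x + t • d j)) (𝓝[>] 0) (𝓝 (B i x)) := by
    intro i j
    have hc : ContinuousAt (fun t : ℝ => x + t • d j) 0 := by fun_prop
    have hx : x + (0 : ℝ) • d j = x := by simp
    have := (ContinuousAt.comp (f := fun t : ℝ => x + t • d j) (g := B i) (x := 0)
      (by rw [hx]; exact hB i) hc).tendsto
    simp only [Function.comp_def, hx] at this
    exact this.mono_left nhdsWithin_le_nhds
  have hlim : ∀ i j, i ≠ j → Tendsto (fun t : ℝ => A i (x + t • d j)) (𝓝[>] 0)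
      (𝓝 (θ i j + B i x)) := by
    intro i j hij
    simp only [hA]
    exact (tendsto_viewAngle_ray (hd i) (hd j) (hne i j hij)).add (hlimB i j)
  have eα := tendsto_nhds_unique hα ((hlim 0 2 (by decide)).sub (hlim 1 2 (by decide)))
  have eβ := tendsto_nhds_unique hβ ((hlim 1 0 (by decide)).sub (hlim 2 0 (by decide)))
  have eγ := tendsto_nhds_unique hγ ((hlim 2 1 (by decide)).sub (hlim 0 1 (by decide)))
  have s20 : θ 2 0 = -θ 0 2 := arg_neg_div_swap (hd 0) (hd 2) (hne 0 2 (by decide))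
  have s12 : θ 1 2 = -θ 2 1 := arg_neg_div_swap (hd 2) (hd 1) (hne 2 1 (by decide))
  have s01 : θ 0 1 = -θ 1 0 := arg_neg_div_swap (hd 1) (hd 0) (hne 1 0 (by decide))
  intro hsum
  -- The contributions of `B` cancel, and by antisymmetry of `θ` the three limits add up to twice
  -- this sum.
  have hzero : θ 0 2 + θ 2 1 + θ 1 0 = 0 := by
    rw [eα, eβ, eγ, s20, s12, s01] at hsum
    linarith
  have hd' : ∀ i, toComplex (d i) ≠ 0 := fun i => toComplex_ne_zero (hd i)
  have hq : ∀ i j, -(toComplex (d i) / toComplex (d j)) ≠ 0 := fun i j =>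
    neg_ne_zero.2 (div_ne_zero (hd' i) (hd' j))
  -- Modulo `2 * π` the sum is the argument of a product of three negated ratios, which telescopes
  -- to `-1`.
  have hang : ((θ 0 2 + θ 2 1 + θ 1 0 : ℝ) : Real.Angle) = (Real.pi : Real.Angle) := by
    rw [Real.Angle.coe_add, Real.Angle.coe_add, ← Complex.arg_mul_coe_angle (hq 0 2) (hq 2 1),
      ← Complex.arg_mul_coe_angle (mul_ne_zero (hq 0 2) (hq 2 1)) (hq 1 0)]
    have h0 := hd' 0
    have h1 := hd' 1
    have h2 := hd' 2
    have : -(toComplex (d 0) / toComplex (d 2)) * -(toComplex (d 2) / toComplex (d 1)) *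
        -(toComplex (d 1) / toComplex (d 0)) = -1 := by field_simp
    rw [this, Complex.arg_neg_one]
  rw [hzero, Real.Angle.coe_zero] at hang
  exact Real.Angle.pi_ne_zero hang.symm

/-! ### Angle functions of polygonal arcs and of drawings. -/

/-- An angle function for the curve `S` from `x` to `y` which leaves `x` in direction `d`:
a continuous determination, off `S`, of the angle under which `x` and `y` are seen, with the
contribution of an initial segment of `S` split off. -/
structure IsAngleFunction (x y : Plane) (S : Set Plane) (A : Plane → ℝ) (d : Plane)
    (B : Plane → ℝ) : Prop where
  continuousAt : ∀ z ∉ S, ContinuousAt A z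
  coe_eq : ∀ z ∉ S, (A z : Real.Angle) =
    Complex.arg (toComplex y - toComplex z) - Complex.arg (toComplex x - toComplex z)
  direction_ne_zero : d ≠ 0
  eq_add : ∀ z, A z = viewAngle x (x + d) z + B z
  continuousAt_rest : ContinuousAt B x
  ray_mem : ∀ t : ℝ, 0 < t → t ≤ 1 → x + t • d ∈ S \ {x}
  isPreconnected : IsPreconnected (S \ {x})
  right_mem : y ∈ S \ {x}

theorem coe_sum_viewAngle (p : ℕ → Plane) (n : ℕ) (z : Plane) (hz : ∀ i ≤ n, z ≠ p i) :
    ((∑ i ∈ Finset.range n, viewAngle (p i) (p (i + 1)) z : ℝ) : Real.Angle) =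
      Complex.arg (toComplex (p n) - toComplex z) - Complex.arg (toComplex (p 0) - toComplex z) := by
  induction n with
  | zero => simp
  | succ n ih =>
    rw [Finset.sum_range_succ, Real.Angle.coe_add, ih fun i hi => hz i (by omega),
      coe_viewAngle (hz n (by omega)) (hz (n + 1) le_rfl)]
    abel

/-- The view angles of the segments are added up. Only the first segment contains `x`, so the
remaining sum is continuous there. -/
theorem IsPolygonalArc.exists_isAngleFunction {x y : Plane} {S : Set Plane}
    (h : IsPolygonalArc x y S) (hxy : x ≠ y) : ∃ A d B, IsAngleFunction x y S A d B := by
  obtain ⟨n, p, rfl, rfl, hinj, hdisj, rfl⟩ := h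
  obtain ⟨m, rfl⟩ : ∃ m, n = m + 1 := by
    cases n with
    | zero => exact absurd rfl hxy
    | succ m => exact ⟨m, rfl⟩
  have hvert : ∀ i ≤ m + 1, p i ∈ {z | ∃ i, i < m + 1 ∧ z ∈ segment ℝ (p i) (p (i + 1))} := by
    intro i hi
    rcases Nat.lt_or_ge i (m + 1) with hlt | hge
    · exact ⟨i, hlt, left_mem_segment ℝ _ _⟩
    · obtain rfl : i = m + 1 := by omega
      exact ⟨m, by omega, right_mem_segment ℝ _ _⟩
  have h01 : p 1 ≠ p 0 := fun he => absurd (hinj 1 0 (by omega) (by omega) he) (by omega)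
  have h0 : ∀ i, 0 < i → i < m + 1 → p 0 ∉ segment ℝ (p i) (p (i + 1)) := by
    intro i hi hlt hmem
    obtain ⟨rfl, he⟩ := hdisj 0 i hi hlt _ (left_mem_segment ℝ _ _) hmem
    exact h01 he.symm
  have hdir : p 1 - p 0 ≠ 0 := sub_ne_zero.2 h01
  have hray : ∀ t : ℝ, 0 < t → t ≤ 1 → p 0 + t • (p 1 - p 0) ∈ segment ℝ (p 0) (p 1) \ {p 0} := by
    intro t ht ht1
    refine ⟨?_, ?_⟩
    · rw [segment_eq_image']
      exact ⟨t, ⟨ht.le, ht1⟩, rfl⟩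
    · intro he
      have he : p 0 + t • (p 1 - p 0) = p 0 := he
      rw [add_eq_left, smul_eq_zero] at he
      exact he.elim ht.ne' hdir
  refine ⟨fun z => ∑ i ∈ Finset.range (m + 1), viewAngle (p i) (p (i + 1)) z, p 1 - p 0,
    fun z => ∑ i ∈ Finset.range m, viewAngle (p (i + 1)) (p (i + 1 + 1)) z, ?_, ?_, hdir, ?_, ?_,
    ?_, ?_, ?_⟩
  · intro z hz
    refine tendsto_finsetSum _ fun i hi => continuousAt_viewAngle fun hm => hz ?_
    exact ⟨i, Finset.mem_range.1 hi, hm⟩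
  · intro z hz
    exact coe_sum_viewAngle p (m + 1) z fun i hi he => hz (he ▸ hvert i hi)
  · intro z
    rw [Finset.sum_range_succ', add_comm]
    simp
  · refine tendsto_finsetSum _ fun i hi => continuousAt_viewAngle ?_
    exact h0 (i + 1) (by omega) (by have := Finset.mem_range.1 hi; omega)
  · intro t ht ht1
    exact ⟨⟨0, by omega, (hray t ht ht1).1⟩, (hray t ht ht1).2⟩
  · have hset : {z | ∃ i, i < m + 1 ∧ z ∈ segment ℝ (p i) (p (i + 1))} \ {p 0} =
        ⋃ i ∈ Set.Iic m, (segment ℝ (p i) (p (i + 1)) \ {p 0}) := by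
      ext z
      simp only [Set.mem_sdiff, Set.mem_ofPred_eq, Set.mem_singleton_iff, Set.mem_iUnion,
        Set.mem_Iic, exists_prop, Nat.lt_succ_iff]
      tauto
    rw [hset]
    refine IsPreconnected.biUnion_of_chain Set.ordConnected_Iic ?_ ?_
    · intro i hi
      have hi : i ≤ m := hi
      rcases Nat.eq_zero_or_pos i with rfl | hpos
      · have : segment ℝ (p 0) (p (0 + 1)) \ {p 0} =
            (fun t : ℝ => p 0 + t • (p 1 - p 0)) '' Set.Ioc 0 1 := by
          ext z
          constructor
          · rintro ⟨hz, hz0⟩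
            rw [segment_eq_image'] at hz
            obtain ⟨t, ⟨ht0, ht1⟩, rfl⟩ := hz
            refine ⟨t, ⟨lt_of_le_of_ne ht0 ?_, ht1⟩, rfl⟩
            rintro rfl
            exact hz0 (by simp)
          · rintro ⟨t, ⟨ht0, ht1⟩, rfl⟩
            exact hray t ht0 ht1
        rw [this]
        exact isPreconnected_Ioc.image _ (by fun_prop)
      · rw [Set.sdiff_singleton_eq_self (h0 i hpos (by omega))]
        exact (convex_segment _ _).isPreconnected
    · intro i hi hi'
      have hi' : i + 1 ≤ m := hi'
      refine ⟨p (i + 1), ⟨right_mem_segment ℝ _ _, ?_⟩, ⟨left_mem_segment ℝ _ _, ?_⟩⟩ <;>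
      · intro he
        exact absurd (hinj (i + 1) 0 (by omega) (by omega) he) (by omega)
  · exact ⟨hvert (m + 1) le_rfl, fun he => hxy he.symm⟩

/-- Functions whose values differ by multiples of `2 * π` have constant difference on a
preconnected set on which they are continuous. -/
theorem sub_eq_sub_of_coe_angle_eq {C : Set Plane} (hC : IsPreconnected C) {f g : Plane → ℝ}
    (hf : ∀ z ∈ C, ContinuousAt f z) (hg : ∀ z ∈ C, ContinuousAt g z)
    (hfg : ∀ z ∈ C, (f z : Real.Angle) = g z) {z w : Plane} (hz : z ∈ C) (hw : w ∈ C) :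
    f z - g z = f w - g w := by
  have hcont : ContinuousOn (fun z => (f z - g z) / (2 * Real.pi)) C := fun z hz =>
    (((hf z hz).sub (hg z hz)).div_const _).continuousWithinAt
  have hpi : (2 * Real.pi : ℝ) ≠ 0 := by positivity
  have hmaps : Set.MapsTo (fun z => (f z - g z) / (2 * Real.pi)) C (Set.range ((↑) : ℤ → ℝ)) := by
    intro z hz
    obtain ⟨k, hk⟩ := Real.Angle.angle_eq_iff_two_pi_dvd_sub.1 (hfg z hz)
    exact ⟨k, by simp only [hk]; field_simp⟩
  have := hC.constant_of_mapsTo (T := Set.range ((↑) : ℤ → ℝ)) ?_ hcont hmaps hz hw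
  · simpa [div_left_inj' hpi] using this
  · exact ⟨Int.isClosedEmbedding_coe_real.isEmbedding.toHomeomorph.symm.isEmbedding.discreteTopology⟩

variable {V : Type*} {G : SimpleGraph V}

/-- Along the half-open curve of an edge `s(u, w)`, no edge avoiding `w` is met. -/
theorem PlaneEmbedding.notMem_curve_of_mem_halfEdge (D : G.PlaneEmbedding) {u w a b : V}
    (huw : G.Adj u w) (hab : G.Adj a b) (hwa : w ≠ a) (hwb : w ≠ b) {z : Plane}
    (hz : z ∈ D.curve s(u, w) \ {D.pos u}) : z ∉ D.curve s(a, b) := by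
  intro hz'
  have hw : w ∉ s(a, b) := by simp [hwa, hwb]
  have hne : s(u, w) ≠ s(a, b) := fun h => hw (h ▸ Sym2.mem_mk_right u w)
  obtain ⟨x, hx, hx', rfl⟩ := D.curve_inter _ huw _ hab hne z hz.1 hz'
  rcases Sym2.mem_iff.1 hx with rfl | rfl
  · exact hz.2 rfl
  · exact hw hx'

/-- Angle functions for all edges of an embedding with a face incident with all vertices, together
with that face. -/
structure OuterDrawing (D : G.PlaneEmbedding) (F : Set Plane) (A : V → V → Plane → ℝ)
    (d : V → V → Plane) (B : V → V → Plane → ℝ) : Prop where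
  angle : ∀ u v, G.Adj u v →
    IsAngleFunction (D.pos u) (D.pos v) (D.curve s(u, v)) (A u v) (d u v) (B u v)
  face_isPreconnected : IsPreconnected F
  face_nonempty : F.Nonempty
  notMem_curve_of_mem_face : ∀ u v, G.Adj u v → ∀ z ∈ F, z ∉ D.curve s(u, v)
  pos_mem_closure : ∀ v, D.pos v ∈ closure F

theorem IsOuterplanar.exists_outerDrawing (h : G.IsOuterplanar) :
    ∃ (D : G.PlaneEmbedding) (F : Set Plane) (A : V → V → Plane → ℝ) (d : V → V → Plane)
      (B : V → V → Plane → ℝ), OuterDrawing D F A d B := by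
  obtain ⟨D, F, ⟨x, hx, rfl⟩, hF⟩ := h
  have hA : ∀ u v, ∃ A d B, G.Adj u v →
      IsAngleFunction (D.pos u) (D.pos v) (D.curve s(u, v)) A d B := by
    intro u v
    by_cases huv : G.Adj u v
    · obtain ⟨A, d, B, hAB⟩ := (D.isPolygonalArc_curve u v huv).exists_isAngleFunction
        fun he => huv.ne (D.pos_injective he)
      exact ⟨A, d, B, fun _ => hAB⟩
    · exact ⟨0, 0, 0, fun h => absurd h huv⟩
  choose A d B hAB using hA
  refine ⟨D, _, A, d, B, hAB, isPreconnected_connectedComponentIn,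
    ⟨x, mem_connectedComponentIn hx⟩, ?_, fun v => frontier_subset_closure (hF v)⟩
  intro u v huv z hz hz'
  refine connectedComponentIn_subset _ _ hz (Or.inr ?_)
  simp only [Set.mem_iUnion]
  exact ⟨s(u, v), huv, hz'⟩

namespace OuterDrawing

variable {D : G.PlaneEmbedding} {F : Set Plane} {A : V → V → Plane → ℝ} {d : V → V → Plane}
  {B : V → V → Plane → ℝ}

/-- A set between a connected set and its closure is connected; this is the use made of all vertices
lying on the boundary of `F`. -/
theorem isPreconnected_insert (h : OuterDrawing D F A d B) (w : V) :
    IsPreconnected (insert (D.pos w) F) :=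
  h.face_isPreconnected.subset_closure (Set.subset_insert _ _)
    (Set.insert_subset (h.pos_mem_closure w) subset_closure)

theorem isPreconnected_union_halfEdge (h : OuterDrawing D F A d B) {u w : V} (huw : G.Adj u w) :
    IsPreconnected (insert (D.pos w) F ∪ D.curve s(u, w) \ {D.pos u}) :=
  (h.isPreconnected_insert w).union (D.pos w) (Set.mem_insert _ _) (h.angle u w huw).right_mem
    (h.angle u w huw).isPreconnected

theorem notMem_curve_of_mem_insert (h : OuterDrawing D F A d B) {w a b : V} (hab : G.Adj a b)
    (hwa : w ≠ a) (hwb : w ≠ b) {z : Plane} (hz : z ∈ insert (D.pos w) F) :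
    z ∉ D.curve s(a, b) := by
  rcases hz with rfl | hz
  · intro hz
    have := D.mem_of_pos_mem_curve _ hab w hz
    simp [hwa, hwb] at this
  · exact h.notMem_curve_of_mem_face a b hab z hz

theorem notMem_curve_of_mem_union (h : OuterDrawing D F A d B) {u w a b : V} (huw : G.Adj u w)
    (hab : G.Adj a b) (hwa : w ≠ a) (hwb : w ≠ b) {z : Plane}
    (hz : z ∈ insert (D.pos w) F ∪ D.curve s(u, w) \ {D.pos u}) : z ∉ D.curve s(a, b) := by
  rcases hz with hz | hz
  · exact h.notMem_curve_of_mem_insert hab hwa hwb hz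
  · exact D.notMem_curve_of_mem_halfEdge huw hab hwa hwb hz

theorem distinctRays (h : OuterDrawing D F A d B) {u v w : V} (huv : G.Adj u v)
    (huw : G.Adj u w) (hvw : v ≠ w) : DistinctRays (d u v) (d u w) := by
  intro s t hs ht he
  have hst : 0 < s + t := add_pos hs ht
  have h1 := (h.angle u v huv).ray_mem (s / (s + t)) (by positivity)
    ((div_le_one hst).2 (by linarith))
  have h2 := (h.angle u w huw).ray_mem (t / (s + t)) (by positivity)
    ((div_le_one hst).2 (by linarith))
  have heq : (s / (s + t)) • d u v = (t / (s + t)) • d u w := by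
    rw [div_eq_inv_mul, div_eq_inv_mul, mul_smul, mul_smul, he]
  rw [heq] at h1
  exact D.notMem_curve_of_mem_halfEdge huv huw huv.ne' hvw h1 h2.1

/-- Carries a value known on the face to the branch point `u`, along the edge from `w`. -/
theorem tendsto_of_eq_on_ray (h : OuterDrawing D F A d B) {u w : V} (huw : G.Adj u w)
    {f : Plane → ℝ} {α : ℝ}
    (hf : ∀ z ∈ insert (D.pos w) F ∪ D.curve s(u, w) \ {D.pos u}, f z = α) :
    Tendsto (fun t : ℝ => f (D.pos u + t • d u w)) (𝓝[>] 0) (𝓝 α) := by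
  refine tendsto_const_nhds.congr' ?_
  filter_upwards [Ioc_mem_nhdsGT (zero_lt_one' ℝ)] with t ht
  exact (hf _ (Or.inr ((h.angle u w huw).ray_mem t ht.1 ht.2))).symm

/-- Along a walk, the angles add up to the angle under which its ends are seen. -/
theorem sum_coe_eq (h : OuterDrawing D F A d B) {p : ℕ → V} {n : ℕ}
    (hp : ∀ i < n, G.Adj (p i) (p (i + 1))) {z : Plane}
    (hz : ∀ i < n, z ∉ D.curve s(p i, p (i + 1))) :
    ((∑ i ∈ Finset.range n, A (p i) (p (i + 1)) z : ℝ) : Real.Angle) =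
      Complex.arg (toComplex (D.pos (p n)) - toComplex z) -
        Complex.arg (toComplex (D.pos (p 0)) - toComplex z) := by
  induction n with
  | zero => simp
  | succ n ih =>
    rw [Finset.sum_range_succ, Real.Angle.coe_add,
      ih (fun i hi => hp i (by omega)) fun i hi => hz i (by omega),
      (h.angle _ _ (hp n (by omega))).coe_eq z (hz n (by omega))]
    abel

theorem continuousAt_sum (h : OuterDrawing D F A d B) {p : ℕ → V} {n : ℕ}
    (hp : ∀ i < n, G.Adj (p i) (p (i + 1))) {z : Plane}
    (hz : ∀ i < n, z ∉ D.curve s(p i, p (i + 1))) :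
    ContinuousAt (fun z => ∑ i ∈ Finset.range n, A (p i) (p (i + 1)) z) z :=
  tendsto_finsetSum _ fun i hi =>
    (h.angle _ _ (hp i (Finset.mem_range.1 hi))).continuousAt z (hz i (Finset.mem_range.1 hi))

end OuterDrawing

/-! ### Excluded subgraphs. -/

/-- An outerplanar graph contains no three internally disjoint paths of length at least two with
the same ends. -/
theorem IsOuterplanar.not_exists_theta (h : G.IsOuterplanar) {u v : V} (p : Fin 3 → ℕ → V)
    (n : Fin 3 → ℕ) (hn : ∀ k, 0 < n k) (hu : ∀ k, p k 0 = u) (hv : ∀ k, p k (n k) = v)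
    (hadj : ∀ k, ∀ i < n k, G.Adj (p k i) (p k (i + 1)))
    (hne : ∀ k i, 0 < i → i ≤ n k → p k i ≠ u)
    (hdisj : ∀ k l, k ≠ l → ∀ i ≤ n l, p k 1 ≠ p l i) : False := by
  obtain ⟨D, F, A, d, B, hD⟩ := h.exists_outerDrawing
  obtain ⟨z₀, hz₀⟩ := hD.face_nonempty
  have hu1 : ∀ k, G.Adj u (p k 1) := fun k => by
    have := hadj k 0 (hn k)
    rwa [hu] at this
  set S : Fin 3 → Plane → ℝ := fun k z =>
    ∑ i ∈ Finset.range (n k), A (p k i) (p k (i + 1)) z with hS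
  -- Paths `l` and `m` have the same ends, so their angle sums agree modulo `2 * π` off both; the
  -- first edge of path `k` links the face to `u` without meeting them.
  have hconst : ∀ k l m, k ≠ l → k ≠ m →
      ∀ z ∈ insert (D.pos (p k 1)) F ∪ D.curve s(u, p k 1) \ {D.pos u},
        S l z - S m z = S l z₀ - S m z₀ := by
    intro k l m hkl hkm z hz
    have hmiss : ∀ l, k ≠ l → ∀ z ∈ insert (D.pos (p k 1)) F ∪ D.curve s(u, p k 1) \ {D.pos u},
        ∀ i < n l, z ∉ D.curve s(p l i, p l (i + 1)) := fun l hkl z hz i hi =>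
      hD.notMem_curve_of_mem_union (hu1 k) (hadj l i hi) (hdisj k l hkl i hi.le)
        (hdisj k l hkl (i + 1) hi) hz
    refine sub_eq_sub_of_coe_angle_eq (hD.isPreconnected_union_halfEdge (hu1 k))
      (fun z hz => hD.continuousAt_sum (hadj l) (hmiss l hkl z hz))
      (fun z hz => hD.continuousAt_sum (hadj m) (hmiss m hkm z hz)) (fun z hz => ?_) hz
      (Or.inl (Or.inr hz₀))
    rw [hD.sum_coe_eq (hadj l) (hmiss l hkl z hz), hD.sum_coe_eq (hadj m) (hmiss m hkm z hz),
      hu, hu, hv, hv]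
  refine branch_point_sum_ne_zero (x := D.pos u) (d := fun k => d u (p k 1)) (A := S)
    (B := fun k z => B u (p k 1) z +
      ∑ i ∈ Finset.range (n k - 1), A (p k (i + 1)) (p k (i + 1 + 1)) z)
    (α := S 0 z₀ - S 1 z₀) (β := S 1 z₀ - S 2 z₀) (γ := S 2 z₀ - S 0 z₀)
    (fun k => (hD.angle _ _ (hu1 k)).direction_ne_zero)
    (fun k l hkl => hD.distinctRays (hu1 k) (hu1 l) (hdisj k l hkl 1 (hn l))) ?_ ?_
    (hD.tendsto_of_eq_on_ray (hu1 2) (hconst 2 0 1 (by decide) (by decide)))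
    (hD.tendsto_of_eq_on_ray (hu1 0) (hconst 0 1 2 (by decide) (by decide)))
    (hD.tendsto_of_eq_on_ray (hu1 1) (hconst 1 2 0 (by decide) (by decide))) (by ring)
  · intro k z
    obtain ⟨m, hm⟩ : ∃ m, n k = m + 1 := ⟨n k - 1, by have := hn k; omega⟩
    simp only [hS, hm, Finset.sum_range_succ', Nat.add_sub_cancel, hu, zero_add,
      (hD.angle _ _ (hu1 k)).eq_add z]
    ring
  · intro k
    refine (hD.angle _ _ (hu1 k)).continuousAt_rest.add ?_
    refine hD.continuousAt_sum (p := fun i => p k (i + 1)) (fun i hi => hadj k (i + 1) (by omega))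
      fun i hi hmem => ?_
    have := D.mem_of_pos_mem_curve _ (hadj k (i + 1) (by omega)) u hmem
    rcases Sym2.mem_iff.1 this with he | he
    · exact hne k (i + 1) (by omega) (by omega) he.symm
    · exact hne k (i + 1 + 1) (by omega) (by omega) he.symm

/-- An outerplanar graph contains no complete graph on four vertices. -/
theorem IsOuterplanar.not_exists_four_clique (h : G.IsOuterplanar) {c x e y : V}
    (hcx : G.Adj c x) (hce : G.Adj c e) (hcy : G.Adj c y) (hex : G.Adj e x) (hyx : G.Adj y x)
    (hey : G.Adj e y) : False := by
  obtain ⟨D, F, A, d, B, hD⟩ := h.exists_outerDrawing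
  obtain ⟨z₀, hz₀⟩ := hD.face_nonempty
  have hcont : ∀ {C : Set Plane} {a b : V}, G.Adj a b → (∀ z ∈ C, z ∉ D.curve s(a, b)) →
      ∀ z ∈ C, ContinuousAt (A a b) z := fun hab hC z hz =>
    (hD.angle _ _ hab).continuousAt z (hC z hz)
  -- the winding number around a triangle is constant on connected sets avoiding it
  have htri : ∀ {C : Set Plane} {a b m : V}, IsPreconnected C → G.Adj a b → G.Adj a m → G.Adj m b →
      (∀ z ∈ C, z ∉ D.curve s(a, b)) → (∀ z ∈ C, z ∉ D.curve s(a, m)) →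
      (∀ z ∈ C, z ∉ D.curve s(m, b)) → z₀ ∈ C → ∀ z ∈ C,
      A a b z - (A a m z + A m b z) = A a b z₀ - (A a m z₀ + A m b z₀) := by
    intro C a b m hC hab ham hmb h1 h2 h3 hz₀ z hz
    refine sub_eq_sub_of_coe_angle_eq (f := A a b) (g := fun z => A a m z + A m b z) hC
      (hcont hab h1) (fun z hz => (hcont ham h2 z hz).add (hcont hmb h3 z hz)) (fun z hz => ?_)
      hz hz₀
    rw [Real.Angle.coe_add, (hD.angle _ _ hab).coe_eq z (h1 z hz),
      (hD.angle _ _ ham).coe_eq z (h2 z hz), (hD.angle _ _ hmb).coe_eq z (h3 z hz)]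
    abel
  have hray : ∀ {u w a b m : V}, G.Adj u w → G.Adj a b → G.Adj a m → G.Adj m b → w ≠ a → w ≠ b →
      w ≠ m → ∀ z ∈ insert (D.pos w) F ∪ D.curve s(u, w) \ {D.pos u},
      A a b z - (A a m z + A m b z) = A a b z₀ - (A a m z₀ + A m b z₀) := by
    intro u w a b m huw hab ham hmb hwa hwb hwm
    exact htri (hD.isPreconnected_union_halfEdge huw) hab ham hmb
      (fun z hz => hD.notMem_curve_of_mem_union huw hab hwa hwb hz)
      (fun z hz => hD.notMem_curve_of_mem_union huw ham hwa hwm hz)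
      (fun z hz => hD.notMem_curve_of_mem_union huw hmb hwm hwb hz) (Or.inl (Or.inr hz₀))
  have hc : ∀ {a b : V}, G.Adj a b → c ≠ a → c ≠ b → ContinuousAt (A a b) (D.pos c) :=
    fun hab ha hb => (hD.angle _ _ hab).continuousAt _
      (hD.notMem_curve_of_mem_insert hab ha hb (Set.mem_insert _ F))
  have hex' := htri (hD.isPreconnected_insert c) hex hey hyx
    (fun z hz => hD.notMem_curve_of_mem_insert hex hce.ne hcx.ne hz)
    (fun z hz => hD.notMem_curve_of_mem_insert hey hce.ne hcy.ne hz)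
    (fun z hz => hD.notMem_curve_of_mem_insert hyx hcy.ne hcx.ne hz) (Or.inr hz₀) _
    (Set.mem_insert _ F)
  -- Both `c e x` and `c y x` end at `x`, so the constancy argument fails along the edge `c x`. The
  -- closed curve they form is split by the edge `e y` into the triangle `e x y`, which avoids `c`,
  -- and the triangle `c y e`, which avoids `x`.
  have hlim : Tendsto (fun t : ℝ =>
      (A c e (D.pos c + t • d c x) + A e x (D.pos c + t • d c x)) -
        (A c y (D.pos c + t • d c x) + A y x (D.pos c + t • d c x))) (𝓝[>] 0)
      (𝓝 (A e x z₀ - (A e y z₀ + A y x z₀) - (A c y z₀ - (A c e z₀ + A e y z₀)))) := by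
    have h1 := hD.tendsto_of_eq_on_ray hcx (hray hcx hcy hce hey hcx.ne' hyx.ne' hex.ne')
    have h2 : Tendsto (fun t : ℝ => A e x (D.pos c + t • d c x) -
        (A e y (D.pos c + t • d c x) + A y x (D.pos c + t • d c x))) (𝓝[>] 0)
        (𝓝 (A e x z₀ - (A e y z₀ + A y x z₀))) := by
      rw [← hex']
      have hx : D.pos c + (0 : ℝ) • d c x = D.pos c := by simp
      have hcf : ContinuousAt (fun z => A e x z - (A e y z + A y x z))
          (D.pos c + (0 : ℝ) • d c x) := by
        rw [hx]
        exact (hc hex hce.ne hcx.ne).sub ((hc hey hce.ne hcy.ne).add (hc hyx hcy.ne hcx.ne))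
      have hcl : ContinuousAt (fun t : ℝ => D.pos c + t • d c x) 0 := by fun_prop
      have := (ContinuousAt.comp (f := fun t : ℝ => D.pos c + t • d c x)
        (g := fun z => A e x z - (A e y z + A y x z)) (x := 0) hcf hcl).tendsto
      simp only [Function.comp_def, hx] at this
      exact this.mono_left nhdsWithin_le_nhds
    refine (h2.sub h1).congr fun t => ?_
    ring
  have h2 := hD.tendsto_of_eq_on_ray hcy (hray hcy hcx hce hex hcy.ne' hyx.ne hey.ne')
  have h1 := (hD.tendsto_of_eq_on_ray hce (hray hce hcx hcy hyx hce.ne' hex.ne hey.ne)).neg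
  -- The three curves from `c` to `x` are the edge itself and the paths through `e` and through `y`.
  refine branch_point_sum_ne_zero (x := D.pos c) (d := ![d c x, d c e, d c y])
    (A := ![A c x, fun z => A c e z + A e x z, fun z => A c y z + A y x z])
    (B := ![B c x, fun z => B c e z + A e x z, fun z => B c y z + A y x z])
    ?_ ?_ ?_ ?_ h2 hlim (h1.congr fun t => ?_) ?_
  · intro i
    fin_cases i
    exacts [(hD.angle _ _ hcx).direction_ne_zero, (hD.angle _ _ hce).direction_ne_zero,
      (hD.angle _ _ hcy).direction_ne_zero]
  · have h01 := hD.distinctRays hcx hce hex.ne'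
    have h02 := hD.distinctRays hcx hcy hyx.ne'
    have h12 := hD.distinctRays hce hcy hey.ne
    intro i j hij
    fin_cases i <;> fin_cases j
    exacts [absurd rfl hij, h01, h02, h01.symm, absurd rfl hij, h12, h02.symm, h12.symm,
      absurd rfl hij]
  · intro i z
    fin_cases i
    · exact (hD.angle _ _ hcx).eq_add z
    · simp [(hD.angle _ _ hce).eq_add z, add_assoc]
    · simp [(hD.angle _ _ hcy).eq_add z, add_assoc]
  · intro i
    fin_cases i
    · exact (hD.angle _ _ hcx).continuousAt_rest
    · exact (hD.angle _ _ hce).continuousAt_rest.add (hc hex hce.ne hcx.ne)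
    · exact (hD.angle _ _ hcy).continuousAt_rest.add (hc hyx hcy.ne hcx.ne)
  · simp
  · ring

/-! ### Attachments of components outside a cycle. -/

/-- The graph obtained by deleting all edges that have an end in `K`. -/
def avoid (G : SimpleGraph V) (K : Set V) : SimpleGraph V where
  Adj a b := G.Adj a b ∧ a ∉ K ∧ b ∉ K
  symm := ⟨fun _ _ h => ⟨h.1.symm, h.2.2, h.2.1⟩⟩
  loopless := ⟨fun _ h => h.1.ne rfl⟩

theorem avoid_le (K : Set V) : G.avoid K ≤ G := fun _ _ h => h.1

theorem Reachable.closed {H : SimpleGraph V} {x y : V} (h : H.Reachable x y) {P : V → Prop}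
    (hx : P x) (hP : ∀ a b, P a → H.Adj a b → P b) : P y := by
  obtain ⟨p⟩ := h
  induction p with
  | nil => exact hx
  | cons hab _ ih => exact ih (hP _ _ hx hab)

theorem notMem_of_avoid_reachable {K : Set V} {x y : V} (h : (G.avoid K).Reachable x y)
    (hx : x ∉ K) : y ∉ K :=
  h.closed (P := fun z => z ∉ K) hx fun _ _ _ hab => hab.2.2

theorem Walk.avoid_reachable {K : Set V} {x y : V} (p : G.Walk x y) (hp : ∀ z ∈ p.support, z ∉ K) :
    (G.avoid K).Reachable x y := by
  induction p with
  | nil => exact Reachable.refl _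
  | cons hab p ih =>
    refine (Adj.reachable (G := G.avoid K) ⟨hab, hp _ (by simp), hp _ (by simp)⟩).trans
      (ih fun z hz => hp z (by simp [hz]))

theorem avoid_reachable_mono {K K' : Set V} (hK : K ⊆ K') {x y : V}
    (h : (G.avoid K').Reachable x y) : (G.avoid K).Reachable x y :=
  h.mono fun a b (hab : (G.avoid K').Adj a b) =>
    ⟨hab.1, fun ha => hab.2.1 (hK ha), fun hb => hab.2.2 (hK hb)⟩

/-- A walk avoiding `K` that enters `T` does so for a first time. -/
theorem exists_adj_of_avoid_reachable {K T : Set V} {x t : V} (h : (G.avoid K).Reachable x t)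
    (hx : x ∉ T) (ht : t ∈ T) :
    ∃ z, (G.avoid (K ∪ T)).Reachable x z ∧ ∃ s ∈ T, s ∉ K ∧ G.Adj z s := by
  by_contra hcon
  push Not at hcon
  have := h.closed (P := fun z => z ∉ T ∧ (G.avoid (K ∪ T)).Reachable x z)
    ⟨hx, Reachable.refl _⟩ fun a b ⟨ha, hxa⟩ hab => by
      have hb : b ∉ T := fun hb => hcon a hxa b hb hab.2.2 hab.1
      exact ⟨hb, hxa.trans (Adj.reachable (G := G.avoid (K ∪ T))
        ⟨hab.1, fun h => h.elim hab.2.1 ha, fun h => h.elim hab.2.2 hb⟩)⟩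
  exact this.1 ht

/-- A cyclic sequence of `n` distinct vertices, consecutive ones being adjacent. -/
structure IsCycleMap (G : SimpleGraph V) {n : ℕ} (f : ZMod n → V) : Prop where
  injective : Function.Injective f
  adj : ∀ i, G.Adj (f i) (f (i + 1))

/-- The positions on the cycle `f` at which the component of `y` outside the cycle is attached. -/
def attachSet (G : SimpleGraph V) {n : ℕ} (f : ZMod n → V) (y : V) : Set (ZMod n) :=
  {i | ∃ z, (G.avoid (Set.range f)).Reachable y z ∧ G.Adj z (f i)}

theorem attachSet_congr {n : ℕ} {f : ZMod n → V} {y z : V}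
    (h : (G.avoid (Set.range f)).Reachable y z) : G.attachSet f y = G.attachSet f z := by
  ext i
  exact ⟨fun ⟨w, hw, hi⟩ => ⟨w, h.symm.trans hw, hi⟩, fun ⟨w, hw, hi⟩ => ⟨w, h.trans hw, hi⟩⟩

theorem IsCycleMap.add_ne {n : ℕ} {f : ZMod n → V} (hf : G.IsCycleMap f) (i : ZMod n) {s : ℕ}
    (hs : 0 < s) (hsn : s < n) : f (i + s) ≠ f i := by
  intro he
  have := hf.injective he
  rw [add_eq_left, ZMod.natCast_eq_zero_iff] at this
  exact absurd (Nat.le_of_dvd hs this) (by omega)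

/-- Two attachments that are not consecutive give a theta graph: the two arcs of the cycle between
them and a path through the component. -/
theorem IsOuterplanar.attachSet_consecutive (h : G.IsOuterplanar) {n : ℕ} [NeZero n]
    {f : ZMod n → V} (hf : G.IsCycleMap f) {y : V} (hy : y ∉ Set.range f) {i j : ZMod n}
    (hi : i ∈ G.attachSet f y) (hj : j ∈ G.attachSet f y) : i = j ∨ j = i + 1 ∨ i = j + 1 := by
  by_contra hcon
  push Not at hcon
  obtain ⟨hij, hij1, hji1⟩ := hcon
  obtain ⟨z, hyz, hz⟩ := hi
  obtain ⟨w, hyw, hw⟩ := hj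
  obtain ⟨P⟩ := hyz.symm.trans hyw
  have hzr : z ∉ Set.range f := notMem_of_avoid_reachable hyz hy
  have hPr : ∀ s k, P.getVert s ≠ f k := fun s k he =>
    notMem_of_avoid_reachable (P.take s).reachable hzr (he ▸ Set.mem_range_self k)
  obtain ⟨t, ht, htn⟩ : ∃ t : ℕ, (t : ZMod n) = j - i ∧ t < n :=
    ⟨(j - i).val, ZMod.natCast_zmod_val _, ZMod.val_lt _⟩
  obtain rfl : j = i + t := by rw [ht]; ring
  have ht0 : t ≠ 0 := by rintro rfl; simp at hij
  have ht1 : t ≠ 1 := by rintro rfl; simp at hij1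
  have htn1 : t ≠ n - 1 := by
    intro he
    apply hji1
    have : ((t + 1 : ℕ) : ZMod n) = 0 := by
      rw [show t + 1 = n by omega]
      exact ZMod.natCast_self n
    push_cast at this
    rw [add_assoc, this, add_zero]
  -- Positions on the backward arc become forward ones, so that `hne` can compare the two arcs.
  have hback : ∀ s : ℕ, s ≤ n → i - (s : ZMod n) = i + ((n - s : ℕ) : ZMod n) := by
    intro s hs
    rw [Nat.cast_sub hs, ZMod.natCast_self]
    ring
  have hne : ∀ s s' : ℕ, s ≤ n → s' < s → s - s' < n → f (i + s) ≠ f (i + s') := by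
    intro s s' hs hlt hsn
    have := hf.add_ne (i + s') (s := s - s') (by omega) hsn
    rwa [Nat.cast_sub hlt.le, show i + (s' : ZMod n) + (s - s') = i + s by ring] at this
  set q : ℕ → V := fun s => if s = 0 then f i else if s ≤ P.length + 1 then P.getVert (s - 1)
    else f (i + t) with hq
  have hqcases : ∀ s, (s = 0 ∧ q s = f i) ∨ (0 < s ∧ s ≤ P.length + 1 ∧ q s = P.getVert (s - 1)) ∨
      (P.length + 1 < s ∧ q s = f (i + t)) := by
    intro s
    simp only [hq]
    by_cases h0 : s = 0
    · left; simp [h0]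
    · right
      by_cases h1 : s ≤ P.length + 1
      · left; simp [h0, h1]; omega
      · right; simp [h0, h1]; omega
  have hq1 : q 1 = z := by simp [hq]
  refine h.not_exists_theta (u := f i) (v := f (i + t))
    ![fun s => f (i + s), fun s => f (i - s), q] ![t, n - t, P.length + 2] ?_ ?_ ?_ ?_ ?_ ?_
  · intro k
    fin_cases k
    · exact Nat.pos_of_ne_zero ht0
    · simpa using htn
    · simp
  · intro k
    fin_cases k <;> simp [hq]
  · intro k
    fin_cases k
    · simp
    · simp only [Fin.mk_one, Fin.isValue, Matrix.cons_val_one, Matrix.cons_val_zero]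
      rw [hback _ (by omega), show n - (n - t) = t by omega]
    · simp [hq]
  · intro k s hs
    fin_cases k
    · simpa [add_assoc] using hf.adj (i + s)
    · have := (hf.adj (i - s - 1)).symm
      rw [sub_add_cancel, sub_sub] at this
      simpa using this
    · have hs : s < P.length + 2 := hs
      change G.Adj (q s) (q (s + 1))
      rcases hqcases s with ⟨rfl, h⟩ | ⟨h0, h1, h⟩ | ⟨h1, h⟩
      · rw [h, zero_add, hq1]
        exact hz.symm
      · rw [h]
        rcases hqcases (s + 1) with ⟨h2, h'⟩ | ⟨h2, h3, h'⟩ | ⟨h2, h'⟩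
        · omega
        · rw [h', Nat.add_sub_cancel]
          have := P.adj_getVert_succ (i := s - 1) (by omega)
          rw [Nat.sub_add_cancel h0] at this
          exact this.1
        · rw [h', show s - 1 = P.length by omega, P.getVert_length]
          exact hw
      · omega
  · intro k s hs0 hs
    fin_cases k
    · have hs : s ≤ t := hs
      exact hf.add_ne i hs0 (by omega)
    · have hs : s ≤ n - t := hs
      change f (i - s) ≠ f i
      rw [hback s (by omega)]
      exact hf.add_ne i (by omega) (by omega)
    · change q s ≠ f i
      rcases hqcases s with ⟨rfl, h⟩ | ⟨h0, h1, h⟩ | ⟨h1, h⟩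
      · omega
      · rw [h]; exact hPr _ _
      · rw [h]; exact hf.add_ne i (by omega) htn
  · have a1 : (fun s : ℕ => f (i + s)) 1 = f (i + (1 : ℕ)) := rfl
    have b1 : (fun s : ℕ => f (i - s)) 1 = f (i + (n - 1 : ℕ)) := by
      simp only
      rw [hback 1 (by omega)]
    intro k l hkl s hs
    fin_cases k <;> fin_cases l <;> first | exact absurd rfl hkl | skip
    · have hs : s ≤ n - t := hs
      change f (i + (1 : ℕ)) ≠ f (i - s)
      rw [hback s (by omega)]
      exact (hne (n - s) 1 (by omega) (by omega) (by omega)).symm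
    · change f (i + (1 : ℕ)) ≠ q s
      rcases hqcases s with ⟨rfl, h⟩ | ⟨h0, h1, h⟩ | ⟨h1, h⟩
      · rw [h]; exact hf.add_ne i one_pos (by omega)
      · rw [h]; exact (hPr _ _).symm
      · rw [h]; exact (hne t 1 (by omega) (by omega) (by omega)).symm
    · have hs : s ≤ t := hs
      change (fun s : ℕ => f (i - s)) 1 ≠ f (i + s)
      rw [b1]
      exact hne (n - 1) s (by omega) (by omega) (by omega)
    · change (fun s : ℕ => f (i - s)) 1 ≠ q s
      rw [b1]
      rcases hqcases s with ⟨rfl, h⟩ | ⟨h0, h1, h⟩ | ⟨h1, h⟩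
      · rw [h]; exact hf.add_ne i (by omega) (by omega)
      · rw [h]; exact (hPr _ _).symm
      · rw [h]; exact hne (n - 1) t (by omega) (by omega) (by omega)
    · change q 1 ≠ f (i + s)
      rw [hq1]
      exact fun he => hzr (he ▸ Set.mem_range_self _)
    · change q 1 ≠ f (i - s)
      rw [hq1]
      exact fun he => hzr (he ▸ Set.mem_range_self _)

/-- The steps between three such elements would force `1 = 0` or `3 = 0` in `ZMod n`. For `n = 3`
this is no obstruction, so triangles are treated separately in `triangle_attach`. -/
theorem not_pairwise_consecutive {n : ℕ} (hn : 4 ≤ n) {i j k : ZMod n} (hij : i ≠ j)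
    (hik : i ≠ k) (hjk : j ≠ k) (h1 : j = i + 1 ∨ i = j + 1) (h2 : k = i + 1 ∨ i = k + 1)
    (h3 : k = j + 1 ∨ j = k + 1) : False := by
  have hc : ∀ s : ℕ, 0 < s → s < 4 → (s : ZMod n) ≠ 0 := by
    intro s h0 h4 he
    rw [ZMod.natCast_eq_zero_iff] at he
    exact absurd (Nat.le_of_dvd h0 he) (by omega)
  have c3 : (3 : ZMod n) ≠ 0 := by exact_mod_cast hc 3 (by norm_num) (by norm_num)
  have c1 : (1 : ZMod n) ≠ 0 := by exact_mod_cast hc 1 (by norm_num) (by norm_num)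
  rcases h1 with rfl | rfl <;> rcases h2 with rfl | h2 <;> rcases h3 with h3 | h3
  all_goals first
    | exact hij rfl
    | exact hik rfl
    | exact hjk rfl
    | exact c1 (by linear_combination h3)
    | exact c1 (by linear_combination -h3)
    | exact c3 (by linear_combination h3)
    | exact c3 (by linear_combination -h3)
    | exact c3 (by linear_combination h2 + h3)
    | exact c3 (by linear_combination h2 - h3)
    | exact c3 (by linear_combination -h2 + h3)
    | exact c3 (by linear_combination -h2 - h3)
    | exact c1 (by linear_combination h2 + h3)
    | exact c1 (by linear_combination h2 - h3)
    | exact c1 (by linear_combination -h2 + h3)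
    | exact c1 (by linear_combination -h2 - h3)

theorem IsOuterplanar.attachSet_not_three (h : G.IsOuterplanar) {n : ℕ} (hn : 4 ≤ n)
    {f : ZMod n → V} (hf : G.IsCycleMap f) {y : V} (hy : y ∉ Set.range f) {i j k : ZMod n}
    (hi : i ∈ G.attachSet f y) (hj : j ∈ G.attachSet f y) (hk : k ∈ G.attachSet f y)
    (hij : i ≠ j) (hik : i ≠ k) (hjk : j ≠ k) : False := by
  have : NeZero n := ⟨by omega⟩
  exact not_pairwise_consecutive hn hij hik hjk
    ((h.attachSet_consecutive hf hy hi hj).resolve_left hij)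
    ((h.attachSet_consecutive hf hy hi hk).resolve_left hik)
    ((h.attachSet_consecutive hf hy hj hk).resolve_left hjk)

theorem Walk.IsPath.isCycleMap {u v : V} {P : G.Walk u v} (hP : P.IsPath) (hvu : G.Adj v u) :
    G.IsCycleMap (fun i : ZMod (P.length + 1) => P.getVert i.val) where
  injective i j hij := by
    refine ZMod.val_injective _ (hP.getVert_injOn ?_ ?_ hij)
    · exact Nat.lt_succ_iff.1 (ZMod.val_lt i)
    · exact Nat.lt_succ_iff.1 (ZMod.val_lt j)
  adj i := by
    obtain ⟨t, rfl, ht⟩ : ∃ t : ℕ, (t : ZMod (P.length + 1)) = i ∧ t < P.length + 1 :=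
      ⟨i.val, ZMod.natCast_zmod_val i, ZMod.val_lt i⟩
    rcases Nat.lt_or_ge t P.length with hlt | hge
    · have h1 : ((t : ZMod (P.length + 1)) + 1).val = t + 1 := by
        rw [← Nat.cast_succ, ZMod.val_cast_of_lt (by omega)]
      simp only [h1, ZMod.val_cast_of_lt ht]
      exact P.adj_getVert_succ hlt
    · obtain rfl : t = P.length := by omega
      have h1 : ((P.length : ZMod (P.length + 1)) + 1).val = 0 := by
        rw [← Nat.cast_succ, ZMod.natCast_self, ZMod.val_zero]
      simp only [h1, ZMod.val_cast_of_lt ht, P.getVert_length, P.getVert_zero]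
      exact hvu

theorem Walk.range_getVert_val {u v : V} (P : G.Walk u v) :
    Set.range (fun i : ZMod (P.length + 1) => P.getVert i.val) = {w | w ∈ P.support} := by
  ext w
  constructor
  · rintro ⟨i, rfl⟩
    exact P.getVert_mem_support _
  · intro hw
    obtain ⟨t, rfl, ht⟩ := Walk.mem_support_iff_exists_getVert.1 hw
    exact ⟨(t : ZMod (P.length + 1)), by simp only [ZMod.val_cast_of_lt (Nat.lt_succ_iff.2 ht)]⟩

theorem Walk.notMem_of_mem_support_avoid {K : Set V} {x z : V} (P : (G.avoid K).Walk x z)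
    (hx : x ∉ K) {w : V} (hw : w ∈ P.support) : w ∉ K := by
  classical
  exact notMem_of_avoid_reachable (P.takeUntil w hw).reachable hx

theorem exists_isCycleMap {K : Set V} {u v x z : V} (P : (G.avoid K).Walk x z) (hP : P.IsPath)
    (hx : x ∉ K) (hu : u ∈ K) (hv : v ∈ K) (hux : G.Adj u x) (hzv : G.Adj z v) (hvu : G.Adj v u) :
    ∃ f : ZMod (P.length + 3) → V, G.IsCycleMap f ∧
      Set.range f = {u, v} ∪ {w | w ∈ P.support} := by
  have hK : ∀ w ∈ P.support, w ∉ K := fun w hw => P.notMem_of_mem_support_avoid hx hw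
  set Q : G.Walk u v := Walk.cons hux ((P.mapLe (avoid_le K)).concat hzv) with hQ
  have hsup : ∀ w, w ∈ Q.support ↔ w = u ∨ w ∈ P.support ∨ w = v := by
    intro w
    simp [hQ, Walk.support_concat]
  have hQp : Q.IsPath := by
    rw [hQ, Walk.cons_isPath_iff, Walk.concat_isPath_iff]
    refine ⟨⟨?_, ?_⟩, ?_⟩
    · simpa using hP
    · intro h
      exact hK v (by simpa using h) hv
    · intro h
      have h : u ∈ P.support ∨ u = v := by simpa [Walk.support_concat] using h
      exact h.elim (fun h => hK u h hu) fun h => hvu.ne h.symm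
  have hlen : Q.length + 1 = P.length + 3 := by simp [hQ]
  rw [← hlen]
  refine ⟨_, hQp.isCycleMap hvu, ?_⟩
  rw [Q.range_getVert_val]
  ext w
  simp only [Set.mem_ofPred_eq, Set.mem_union, Set.mem_insert_iff, Set.mem_singleton_iff, hsup]
  tauto

theorem mem_attachSet_of_adj {n : ℕ} {f : ZMod n → V} {y w : V} (h : G.Adj y w)
    (hw : w ∈ Set.range f) : ∃ i ∈ G.attachSet f y, f i = w := by
  obtain ⟨i, rfl⟩ := hw
  exact ⟨i, ⟨y, Reachable.refl _, h⟩, rfl⟩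

/-- Each case leads to a complete graph on four vertices or to a cycle of length at least four with
three attachments. The first such cycle to try runs through `c`, a path `P` of the component, and
`x`; `e` is attached to it at `c`, at `x` and on `P`. -/
theorem IsOuterplanar.triangle_attach (h : G.IsOuterplanar) {c x e y z₁ z₂ z₃ : V}
    (hcx : G.Adj c x) (hce : G.Adj c e) (hxe : G.Adj x e) (hy : y ∉ ({c, x, e} : Set V))
    (h₁ : (G.avoid {c, x, e}).Reachable y z₁) (h₂ : (G.avoid {c, x, e}).Reachable y z₂)
    (h₃ : (G.avoid {c, x, e}).Reachable y z₃) (hz₁ : G.Adj c z₁) (hz₂ : G.Adj z₂ x)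
    (hz₃ : G.Adj e z₃) : False := by
  obtain ⟨P, hP⟩ := (h₁.symm.trans h₂).exists_isPath
  have hz₁K := notMem_of_avoid_reachable h₁ hy
  have hz₃K := notMem_of_avoid_reachable h₃ hy
  have hPK : ∀ w ∈ P.support, w ∉ ({c, x, e} : Set V) := fun w hw =>
    P.notMem_of_mem_support_avoid hz₁K hw
  obtain ⟨f, hf, hfr⟩ := exists_isCycleMap P hP hz₁K (u := c) (v := x) (by simp) (by simp)
    hz₁ hz₂ hcx.symm
  have hecx : e ∉ ({c, x} : Set V) := by simp [hce.ne', hxe.ne']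
  have he : e ∉ {w | w ∈ P.support} := fun he => hPK e he (by simp)
  have hez₁ : (G.avoid {c, x}).Reachable e z₁ := by
    refine (Adj.reachable (G := G.avoid {c, x}) ⟨hz₃, hecx, fun hm => hz₃K ?_⟩).trans
      (avoid_reachable_mono (K' := {c, x, e}) ?_ (h₃.symm.trans h₁))
    · rcases hm with rfl | rfl <;> simp
    · rintro w (rfl | rfl) <;> simp
  obtain ⟨z, hez, s, hs, -, hzs⟩ := exists_adj_of_avoid_reachable hez₁ he P.start_mem_support
  have hsK := hPK s hs
  simp only [Set.mem_insert_iff, Set.mem_singleton_iff, not_or] at hsK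
  have hef : e ∉ Set.range f := by
    rw [hfr]
    exact fun h => h.elim hecx he
  -- If `P` is one vertex `s`, this cycle is only a triangle. Then either `s` is adjacent to `e`, or
  -- a cycle through `c`, `e` and `s` has `x` attached at these three vertices.
  rcases Nat.eq_zero_or_pos P.length with h0 | hpos
  · obtain rfl := Walk.eq_of_length_eq_zero h0
    have hsz : s = z₁ := by
      obtain ⟨t, rfl, ht⟩ := Walk.mem_support_iff_exists_getVert.1 hs
      rw [show t = 0 by omega, Walk.getVert_zero]
    subst hsz
    by_cases hze : z = e
    · subst hze
      exact h.not_exists_four_clique hcx hce hz₁ hxe.symm hz₂ hzs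
    · obtain ⟨R, hR⟩ := hez.exists_isPath
      have heK : e ∉ ({c, x} ∪ {w | w ∈ P.support} : Set V) := fun h => h.elim hecx he
      obtain ⟨g, hg, hgr⟩ := exists_isCycleMap R hR heK (u := c) (v := s) (by simp)
        (Or.inr P.start_mem_support) hce hzs hz₁.symm
      have hRpos : 0 < R.length :=
        Nat.pos_of_ne_zero fun h0 => hze (Walk.eq_of_length_eq_zero h0).symm
      have hxg : x ∉ Set.range g := by
        rw [hgr]
        rintro ((hm | hm) | hm)
        · exact hcx.ne' hm
        · exact hsK.2.1 hm.symm
        · exact R.notMem_of_mem_support_avoid heK hm (by simp)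
      obtain ⟨i, hi, hie⟩ := mem_attachSet_of_adj hxe
        (show e ∈ Set.range g by rw [hgr]; exact Or.inr R.start_mem_support)
      obtain ⟨j, hj, hjc⟩ := mem_attachSet_of_adj hcx.symm
        (show c ∈ Set.range g by rw [hgr]; simp)
      obtain ⟨k, hk, hks⟩ := mem_attachSet_of_adj hz₂.symm
        (show s ∈ Set.range g by rw [hgr]; simp)
      refine h.attachSet_not_three (by omega) hg hxg hi hj hk ?_ ?_ ?_
      · rintro rfl
        exact hce.ne (hjc.symm.trans hie)
      · rintro rfl
        exact hsK.2.2 (hks.symm.trans hie)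
      · rintro rfl
        exact hsK.1 (hks.symm.trans hjc)
  · obtain ⟨i, hi, hic⟩ := mem_attachSet_of_adj hce.symm
      (show c ∈ Set.range f by rw [hfr]; simp)
    obtain ⟨j, hj, hjx⟩ := mem_attachSet_of_adj hxe.symm
      (show x ∈ Set.range f by rw [hfr]; simp)
    obtain ⟨k, hk⟩ : s ∈ Set.range f := by rw [hfr]; exact Or.inr hs
    have hk' : k ∈ G.attachSet f e := ⟨z, by rwa [hfr], by rwa [hk]⟩
    refine h.attachSet_not_three (by omega) hf hef hi hj hk' ?_ ?_ ?_
    · rintro rfl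
      exact hcx.ne (hic.symm.trans hjx)
    · rintro rfl
      exact hsK.1 (hk.symm.trans hic)
    · rintro rfl
      exact hsK.2.1 (hk.symm.trans hjx)

theorem eq_or_eq_or_eq_of_ne {i j k : ZMod 3} (hij : i ≠ j) (hik : i ≠ k) (hjk : j ≠ k) (l : ZMod 3) :
    l = i ∨ l = j ∨ l = k := by
  revert i j k l
  decide

theorem IsOuterplanar.attachSet_not_three' (h : G.IsOuterplanar) {n : ℕ} (hn : 3 ≤ n)
    {f : ZMod n → V} (hf : G.IsCycleMap f) {y : V} (hy : y ∉ Set.range f) {i j k : ZMod n}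
    (hi : i ∈ G.attachSet f y) (hj : j ∈ G.attachSet f y) (hk : k ∈ G.attachSet f y)
    (hij : i ≠ j) (hik : i ≠ k) (hjk : j ≠ k) : False := by
  rcases Nat.lt_or_ge 3 n with hlt | hge
  · exact h.attachSet_not_three hlt hf hy hi hj hk hij hik hjk
  obtain rfl : n = 3 := by omega
  have hadj : ∀ {a b : ZMod 3}, a ≠ b → G.Adj (f a) (f b) := by
    intro a b hab
    have : b = a + 1 ∨ a = b + 1 := by revert a b; decide
    rcases this with rfl | rfl
    · exact hf.adj a
    · exact (hf.adj b).symm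
  have hrange : Set.range f = {f i, f j, f k} := by
    ext w
    simp only [Set.mem_range, Set.mem_insert_iff, Set.mem_singleton_iff]
    constructor
    · rintro ⟨l, rfl⟩
      rcases eq_or_eq_or_eq_of_ne hij hik hjk l with rfl | rfl | rfl <;> simp
    · rintro (rfl | rfl | rfl) <;> exact ⟨_, rfl⟩
  obtain ⟨z₁, h₁, hz₁⟩ := hi
  obtain ⟨z₂, h₂, hz₂⟩ := hj
  obtain ⟨z₃, h₃, hz₃⟩ := hk
  rw [hrange] at h₁ h₂ h₃ hy
  exact h.triangle_attach (hadj hij) (hadj hik) (hadj hjk) hy h₁ h₂ h₃ hz₁.symm hz₂ hz₃.symm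

/-- In an outerplanar graph every component outside a cycle is attached within an edge of it. -/
theorem IsOuterplanar.exists_attachSet_subset (h : G.IsOuterplanar) {n : ℕ} (hn : 3 ≤ n)
    {f : ZMod n → V} (hf : G.IsCycleMap f) {y : V} (hy : y ∉ Set.range f) :
    ∃ i, G.attachSet f y ⊆ {i, i + 1} := by
  have : NeZero n := ⟨by omega⟩
  rcases (G.attachSet f y).eq_empty_or_nonempty with he | ⟨i, hi⟩
  · exact ⟨0, by simp [he]⟩
  have h1 : (1 : ZMod n) ≠ 0 := by
    have : Fact (1 < n) := ⟨by omega⟩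
    exact one_ne_zero
  by_cases hi1 : i + 1 ∈ G.attachSet f y
  · refine ⟨i, fun j hj => ?_⟩
    by_contra hcon
    simp only [Set.mem_insert_iff, Set.mem_singleton_iff, not_or] at hcon
    exact h.attachSet_not_three' hn hf hy hi hi1 hj (by simpa using h1) (Ne.symm hcon.1)
      (Ne.symm hcon.2)
  · refine ⟨i - 1, fun j hj => ?_⟩
    rw [sub_add_cancel]
    rcases h.attachSet_consecutive hf hy hi hj with rfl | rfl | rfl
    · simp
    · exact absurd hj hi1
    · simp

/-! ### A dominating induced cycle. -/

/-- `x` is outside the closed neighbourhood of `{a, b}`. -/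
structure FarFrom (G : SimpleGraph V) (a b x : V) : Prop where
  ne_left : x ≠ a
  ne_right : x ≠ b
  not_adj_left : ¬ G.Adj x a
  not_adj_right : ¬ G.Adj x b

/-- The component of `x` after deleting `a` and `b`. -/
def farComponent (G : SimpleGraph V) (a b x : V) : Set V :=
  {y | (G.avoid {a, b}).Reachable x y}

theorem farComponent_comm (a b x : V) : G.farComponent a b x = G.farComponent b a x := by
  simp only [farComponent, Set.pair_comm a b]

theorem Walk.two_le_length {x z : V} (p : G.Walk x z) (hne : x ≠ z) (hadj : ¬ G.Adj x z) :
    2 ≤ p.length := by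
  by_contra! hlt
  interval_cases hp : p.length
  · exact hne (Walk.eq_of_length_eq_zero hp)
  · exact hadj (Walk.adj_of_length_eq_one hp)

/-- A vertex of `K` on the walk would be at distance at least two from both ends, so the walk would
have length at least four. -/
theorem avoid_reachable_of_far (hdiam : ∀ x y, ∃ p : G.Walk x y, p.length ≤ 3) {K : Set V}
    {x y : V} (hx : ∀ k ∈ K, x ≠ k ∧ ¬ G.Adj x k) (hy : ∀ k ∈ K, y ≠ k ∧ ¬ G.Adj y k) :
    (G.avoid K).Reachable x y := by
  classical
  obtain ⟨p, hp⟩ := hdiam x y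
  refine p.avoid_reachable fun z hz hzK => ?_
  have h1 := (p.takeUntil z hz).two_le_length (hx z hzK).1 (hx z hzK).2
  have h2 := (p.dropUntil z hz).two_le_length (hy z hzK).1.symm fun h => (hy z hzK).2 h.symm
  have := congrArg Walk.length (p.take_spec hz)
  rw [Walk.length_append] at this
  omega

theorem FarFrom.mem_pair {a b x : V} (h : G.FarFrom a b x) :
    ∀ k ∈ ({a, b} : Set V), x ≠ k ∧ ¬ G.Adj x k := by
  rintro k (rfl | rfl)
  exacts [⟨h.ne_left, h.not_adj_left⟩, ⟨h.ne_right, h.not_adj_right⟩]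

theorem FarFrom.notMem {a b x : V} (h : G.FarFrom a b x) : x ∉ ({a, b} : Set V) :=
  fun hx => (h.mem_pair x hx).1 rfl

/-- Otherwise the component is attached at `a` only. For a neighbour `c` of `a` in it, a vertex far
from the edge `a c` lies in the same component, and its own component after deleting `a` and `c` is
smaller because it misses `c`. -/
theorem exists_mem_farComponent_adj [Finite V]
    (hdiam : ∀ x y, ∃ p : G.Walk x y, p.length ≤ 3)
    (hno : ∀ a b, G.Adj a b → ∃ x, G.FarFrom a b x) {a b x₀ : V}
    (hx₀ : G.FarFrom a b x₀)
    (hmin : ∀ a' b' x', G.Adj a' b' → G.FarFrom a' b' x' →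
      (G.farComponent a b x₀).ncard ≤ (G.farComponent a' b' x').ncard) :
    ∃ c ∈ G.farComponent a b x₀, G.Adj c b := by
  by_contra! hcon
  obtain ⟨c, hc, hca⟩ : ∃ c ∈ G.farComponent a b x₀, G.Adj c a := by
    obtain ⟨p, -⟩ := hdiam x₀ a
    obtain ⟨z, hz, s, hs, -, hzs⟩ := exists_adj_of_avoid_reachable
      (p.avoid_reachable (K := ∅) (by simp)) hx₀.notMem (Set.mem_insert a {b})
    rw [Set.empty_union] at hz
    rcases hs with rfl | rfl
    · exact ⟨z, hz, hzs⟩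
    · exact absurd hzs (hcon z hz)
  have hclosed : ∀ w ∈ G.farComponent a b x₀, ∀ w', G.Adj w w' → w' ≠ a →
      w' ∈ G.farComponent a b x₀ := by
    intro w hw w' hww' hw'a
    have hwK := notMem_of_avoid_reachable hw hx₀.notMem
    refine Reachable.trans (v := w) hw (Adj.reachable (G := G.avoid {a, b}) ⟨hww', hwK, ?_⟩)
    rintro (rfl | rfl)
    · exact hw'a rfl
    · exact hcon w hw hww'
  obtain ⟨x, hx⟩ := hno a c hca.symm
  have hxX : x ∈ G.farComponent a b x₀ := by
    have hr : (G.avoid {a}).Reachable x₀ x := by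
      refine avoid_reachable_of_far hdiam ?_ ?_
      · rintro k rfl
        exact ⟨hx₀.ne_left, hx₀.not_adj_left⟩
      · rintro k rfl
        exact ⟨hx.ne_left, hx.not_adj_left⟩
    exact hr.closed (P := fun w => w ∈ G.farComponent a b x₀) (Reachable.refl _)
      fun w w' hw hww' => hclosed w hw w' hww'.1 hww'.2.2
  have hlt : (G.farComponent a c x).ncard < (G.farComponent a b x₀).ncard := by
    refine Set.ncard_lt_ncard ((Set.ssubset_iff_of_subset fun w hw => ?_).2 ⟨c, hc, ?_⟩)
    · exact Reachable.closed hw (P := fun w => w ∈ G.farComponent a b x₀) hxX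
        fun w w' hw hww' => hclosed w hw w' hww'.1 fun h => hww'.2.2 (by simp [h])
    · exact fun h => notMem_of_avoid_reachable h hx.notMem (by simp)
  exact absurd (hmin a c x hca.symm hx) (by omega)

/-- The edge `a b` closes a shortest path from `a` to `b` with interior in `X`; a chord would
shorten the path. -/
theorem exists_induced_isCycleMap {a b : V} {X : Set V} (hab : G.Adj a b) (haX : a ∉ X)
    (hbX : b ∉ X) {c c' : V} (hc : c ∈ X) (hc' : c' ∈ X) (hca : G.Adj c a) (hcb : G.Adj c' b)
    (hX : ∀ x ∈ X, ∀ y ∈ X, (G.avoid {a, b}).Reachable x y)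
    (hXc : ∀ x ∈ X, ∀ y, G.Adj x y → y ∉ ({a, b} : Set V) → y ∈ X) :
    ∃ (n : ℕ) (f : ZMod n → V), 3 ≤ n ∧ G.IsCycleMap f ∧
      (∀ i j, G.Adj (f i) (f j) → j = i + 1 ∨ i = j + 1) ∧
      a ∈ Set.range f ∧ b ∈ Set.range f ∧ ∃ x ∈ X, x ∈ Set.range f := by
  let H : SimpleGraph V :=
    { Adj := fun u w => G.Adj u w ∧ u ∈ insert a (insert b X) ∧ w ∈ insert a (insert b X) ∧
        ¬ (u ∈ ({a, b} : Set V) ∧ w ∈ ({a, b} : Set V))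
      symm := ⟨fun u w h => ⟨h.1.symm, h.2.2.1, h.2.1, fun h' => h.2.2.2 ⟨h'.2, h'.1⟩⟩⟩
      loopless := ⟨fun u h => h.1.ne rfl⟩ }
  have hHG : H ≤ G := fun _ _ h => h.1
  have hXab : ∀ x ∈ X, x ∉ ({a, b} : Set V) := by
    rintro x hx (rfl | rfl)
    exacts [haX hx, hbX hx]
  have hreach : H.Reachable a b := by
    have h1 : H.Adj a c := ⟨hca.symm, by simp, by simp [hc], fun h => hXab c hc h.2⟩
    have h2 : H.Adj c' b := ⟨hcb, by simp [hc'], by simp, fun h => hXab c' hc' h.1⟩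
    have h3 : c' ∈ X ∧ H.Reachable c c' := by
      refine (hX c hc c' hc').closed (P := fun w => w ∈ X ∧ H.Reachable c w)
        ⟨hc, Reachable.refl _⟩ fun w w' ⟨hw, hcw⟩ hww' => ?_
      have hw' := hXc w hw w' hww'.1 hww'.2.2
      exact ⟨hw', hcw.trans (Adj.reachable (G := H)
        ⟨hww'.1, by simp [hw], by simp [hw'], fun h => hww'.2.1 h.1⟩)⟩
    exact h1.reachable.trans (h3.2.trans h2.reachable)
  obtain ⟨P, hP⟩ := hreach.exists_walk_length_eq_dist
  have hPp : P.IsPath := P.isPath_of_length_eq_dist hP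
  have hlen : 2 ≤ P.length := P.two_le_length hab.ne fun h => h.2.2.2 (by simp)
  have hmem : ∀ s, P.getVert s ∈ insert a (insert b X) := fun s =>
    (P.take s).reachable.closed (P := fun w => w ∈ insert a (insert b X)) (by simp)
      fun w w' _ h => h.2.2.1
  have hinj : ∀ s t, s ≤ P.length → t ≤ P.length → P.getVert s = P.getVert t → s = t :=
    fun s t hs ht h => hPp.getVert_injOn hs ht h
  have hends : ∀ s ≤ P.length, P.getVert s ∈ ({a, b} : Set V) → s = 0 ∨ s = P.length := by
    rintro s hs (h | h)
    · exact Or.inl (hinj s 0 hs (by omega) (by simpa using h))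
    · exact Or.inr (hinj s _ hs le_rfl (by simpa using h))
  set Q : G.Walk a b := P.mapLe hHG with hQ
  have hQlen : Q.length = P.length := by simp [hQ]
  have hQv : ∀ s, Q.getVert s = P.getVert s := by intro s; simp [hQ]
  have hQp : Q.IsPath := by simpa [hQ] using hPp
  have hchord : ∀ s t, s < t → t ≤ P.length → G.Adj (P.getVert s) (P.getVert t) →
      t = s + 1 ∨ (s = 0 ∧ t = P.length) := by
    intro s t hst ht hadj
    by_cases hend : P.getVert s ∈ ({a, b} : Set V) ∧ P.getVert t ∈ ({a, b} : Set V)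
    · rcases hends s (by omega) hend.1 with h1 | h1 <;> rcases hends t ht hend.2 with h2 | h2 <;>
        omega
    · have hH : H.Adj (P.getVert s) (P.getVert t) := ⟨hadj, hmem s, hmem t, hend⟩
      have := dist_le ((P.take s).append (Walk.cons hH (P.drop t)))
      rw [Walk.length_append, Walk.length_cons, Walk.take_length, Walk.drop_length, ← hP] at this
      left
      omega
  refine ⟨Q.length + 1, _, by omega, hQp.isCycleMap hab.symm, ?_, ?_, ?_, P.getVert 1, ?_, ?_⟩
  · intro i j hadj
    obtain ⟨s, rfl, hs⟩ : ∃ t : ℕ, (t : ZMod (Q.length + 1)) = i ∧ t < Q.length + 1 :=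
      ⟨i.val, ZMod.natCast_zmod_val i, ZMod.val_lt i⟩
    obtain ⟨t, rfl, ht⟩ : ∃ t : ℕ, (t : ZMod (Q.length + 1)) = j ∧ t < Q.length + 1 :=
      ⟨j.val, ZMod.natCast_zmod_val j, ZMod.val_lt j⟩
    have hlast : ((P.length : ℕ) : ZMod (Q.length + 1)) + 1 = 0 := by
      rw [← hQlen, ← Nat.cast_succ, ZMod.natCast_self]
    simp only [ZMod.val_cast_of_lt hs, ZMod.val_cast_of_lt ht, hQv] at hadj
    rcases lt_trichotomy s t with hlt | rfl | hlt
    · rcases hchord s t hlt (by omega) hadj with rfl | ⟨rfl, rfl⟩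
      · left; push_cast; rfl
      · right; rw [hlast]; simp
    · exact absurd hadj (G.loopless.irrefl _)
    · rcases hchord t s hlt (by omega) hadj.symm with rfl | ⟨rfl, rfl⟩
      · right; push_cast; rfl
      · left; rw [hlast]; simp
  · rw [Q.range_getVert_val]
    exact Q.start_mem_support
  · rw [Q.range_getVert_val]
    exact Q.end_mem_support
  · have h1 : P.getVert 1 ∉ ({a, b} : Set V) := fun h => by
      rcases hends 1 (by omega) h with h | h <;> omega
    have := hmem 1
    simp only [Set.mem_insert_iff, Set.mem_singleton_iff, not_or] at h1 this
    tauto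
  · rw [Q.range_getVert_val, ← hQv]
    exact Q.getVert_mem_support 1

/-- An outerplanar graph with diameter at most three and no dominating edge has a dominating
induced cycle. -/
theorem IsOuterplanar.exists_dominating_cycle [Finite V] (h : G.IsOuterplanar)
    (hdiam : ∀ x y, ∃ p : G.Walk x y, p.length ≤ 3) (hedge : ∃ a b, G.Adj a b)
    (hno : ∀ a b, G.Adj a b → ∃ x, G.FarFrom a b x) :
    ∃ (n : ℕ) (f : ZMod n → V), 3 ≤ n ∧ G.IsCycleMap f ∧
      (∀ i j, G.Adj (f i) (f j) → j = i + 1 ∨ i = j + 1) ∧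
      ∀ y ∉ Set.range f, ∃ i, G.Adj y (f i) := by
  obtain ⟨a₁, b₁, hab₁⟩ := hedge
  obtain ⟨x₁, hx₁⟩ := hno a₁ b₁ hab₁
  -- The cycle is built through an edge `a b` and a far component of minimum size.
  obtain ⟨⟨a, b, x₀⟩, ⟨hab, hx₀⟩, hmin⟩ := Set.exists_min_image
    {q : V × V × V | G.Adj q.1 q.2.1 ∧ G.FarFrom q.1 q.2.1 q.2.2}
    (fun q => (G.farComponent q.1 q.2.1 q.2.2).ncard) (Set.toFinite _) ⟨(a₁, b₁, x₁), hab₁, hx₁⟩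
  replace hmin : ∀ a' b' x', G.Adj a' b' → G.FarFrom a' b' x' →
      (G.farComponent a b x₀).ncard ≤ (G.farComponent a' b' x').ncard :=
    fun a' b' x' h1 h2 => hmin (a', b', x') ⟨h1, h2⟩
  simp only at hab hx₀
  obtain ⟨c', hc', hcb⟩ := exists_mem_farComponent_adj hdiam hno hx₀ hmin
  obtain ⟨c, hc, hca⟩ := exists_mem_farComponent_adj hdiam hno (a := b) (b := a)
    ⟨hx₀.2, hx₀.1, hx₀.4, hx₀.3⟩ (by rwa [farComponent_comm])
  rw [farComponent_comm] at hc
  have hnot : ∀ w ∈ G.farComponent a b x₀, w ∉ ({a, b} : Set V) := fun w hw =>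
    notMem_of_avoid_reachable hw hx₀.notMem
  obtain ⟨n, f, hn, hf, hchord, ⟨ia, ha⟩, ⟨ib, hb⟩, x, hxX, hxf⟩ :=
    exists_induced_isCycleMap (X := G.farComponent a b x₀) hab
      (fun h => hnot a h (by simp)) (fun h => hnot b h (by simp)) hc hc' hca hcb
      (fun x hx y hy => Reachable.trans (Reachable.symm hx) hy)
      fun x hx y hxy hy => Reachable.trans (v := x) hx
        (Adj.reachable (G := G.avoid {a, b}) ⟨hxy, hnot x hx, hy⟩)
  refine ⟨n, f, hn, hf, hchord, fun y hy => ?_⟩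
  by_contra! hcon
  obtain ⟨i, hi⟩ := h.exists_attachSet_subset hn hf hy
  have hfar : ∀ j k, G.FarFrom (f j) (f k) y := fun j k =>
    ⟨fun he => hy (he ▸ Set.mem_range_self _), fun he => hy (he ▸ Set.mem_range_self _),
      hcon j, hcon k⟩
  have hyab : G.FarFrom a b y := ha ▸ hb ▸ hfar ia ib
  have hsub : ∀ w ∈ G.farComponent (f i) (f (i + 1)) y,
      (G.avoid (Set.range f)).Reachable y w := by
    intro w hw
    refine Reachable.closed hw (P := fun w => (G.avoid (Set.range f)).Reachable y w)
      (Reachable.refl _) fun w w' hw hww' => ?_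
    refine hw.trans (Adj.reachable (G := G.avoid (Set.range f))
      ⟨hww'.1, notMem_of_avoid_reachable hw hy, ?_⟩)
    rintro ⟨j, rfl⟩
    rcases hi (show j ∈ G.attachSet f y from ⟨w, hw, hww'.1⟩) with rfl | hj
    · exact hww'.2.2 (by simp)
    · rw [Set.mem_singleton_iff] at hj
      exact hww'.2.2 (by simp [hj])
  -- By `hsub` the component of `y` avoids the whole cycle, hence `a`, `b` and `x`. As `y` and `x₀`
  -- are both far from `a b`, it lies in the minimal component, of which it misses `x`.
  have hlt : (G.farComponent (f i) (f (i + 1)) y).ncard < (G.farComponent a b x₀).ncard := by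
    refine Set.ncard_lt_ncard ((Set.ssubset_iff_of_subset fun w hw => ?_).2 ⟨x, hxX, fun hx => ?_⟩)
    · refine Reachable.trans (v := y) (avoid_reachable_of_far hdiam hx₀.mem_pair hyab.mem_pair)
        (avoid_reachable_mono ?_ (hsub w hw))
      rintro _ (rfl | rfl)
      exacts [⟨ia, ha⟩, ⟨ib, hb⟩]
    · exact notMem_of_avoid_reachable (hsub x hx) hy hxf
  exact absurd (hmin _ _ y (hf.adj i) (hfar _ _)) (by omega)

/-! ### Retraction onto an induced cycle and the bound on its length. -/

/-- An outerplanar graph retracts onto each of its induced cycles. -/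
theorem IsOuterplanar.exists_retraction (h : G.IsOuterplanar) {n : ℕ} (hn : 3 ≤ n)
    {f : ZMod n → V} (hf : G.IsCycleMap f)
    (hchord : ∀ i j, G.Adj (f i) (f j) → j = i + 1 ∨ i = j + 1) :
    ∃ r : V → ZMod n, (∀ i, r (f i) = i) ∧
      (∀ x y, G.Adj x y → r y = r x ∨ r y = r x + 1 ∨ r x = r y + 1) ∧
      ∀ x y, x ∉ Set.range f → G.Adj x y → r y = r x ∨ r y = r x + 1 := by
  classical
  -- The choice depends on the attachment set alone, so it is constant on each component outside the
  -- cycle.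
  let σ : Set (ZMod n) → ZMod n := fun S => if hS : ∃ i, S ⊆ {i, i + 1} then hS.choose else 0
  have hσ : ∀ y ∉ Set.range f, G.attachSet f y ⊆
      {σ (G.attachSet f y), σ (G.attachSet f y) + 1} := by
    intro y hy
    have hS := h.exists_attachSet_subset hn hf hy
    simp only [σ, dif_pos hS]
    exact hS.choose_spec
  let r : V → ZMod n := fun y => if hy : ∃ i, f i = y then hy.choose else σ (G.attachSet f y)
  have hrf : ∀ i, r (f i) = i := fun i => by
    have hy : ∃ j, f j = f i := ⟨i, rfl⟩
    simp only [r, dif_pos hy]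
    exact hf.injective hy.choose_spec
  have hrn : ∀ y ∉ Set.range f, r y = σ (G.attachSet f y) := fun y hy => by
    simp only [r]
    exact dif_neg hy
  have hout : ∀ x y, x ∉ Set.range f → G.Adj x y → r y = r x ∨ r y = r x + 1 := by
    intro x y hx hxy
    by_cases hy : y ∈ Set.range f
    · obtain ⟨j, rfl⟩ := hy
      rw [hrf, hrn x hx]
      exact hσ x hx ⟨x, Reachable.refl _, hxy⟩
    · left
      rw [hrn x hx, hrn y hy,
        attachSet_congr (Adj.reachable (G := G.avoid (Set.range f)) ⟨hxy, hx, hy⟩)]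
  refine ⟨r, hrf, fun x y hxy => ?_, hout⟩
  by_cases hx : x ∈ Set.range f
  · by_cases hy : y ∈ Set.range f
    · obtain ⟨i, rfl⟩ := hx
      obtain ⟨j, rfl⟩ := hy
      rw [hrf, hrf]
      exact Or.inr (hchord i j hxy)
    · rcases hout y x hy hxy.symm with h | h
      · exact Or.inl h.symm
      · exact Or.inr (Or.inr h)
  · rcases hout x y hx hxy with h | h
    · exact Or.inl h
    · exact Or.inr (Or.inl h)

theorem Walk.exists_eq_add_intCast {n : ℕ} {r : V → ZMod n}
    (hr : ∀ x y, G.Adj x y → r y = r x ∨ r y = r x + 1 ∨ r x = r y + 1) {x y : V}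
    (p : G.Walk x y) : ∃ m : ℤ, -p.length ≤ m ∧ m ≤ p.length ∧ r y = r x + m := by
  induction p with
  | nil => exact ⟨0, by simp, by simp, by simp⟩
  | cons hxz p ih =>
    obtain ⟨m, h1, h2, h3⟩ := ih
    rw [Walk.length_cons]
    push_cast
    rcases hr _ _ hxz with h | h | h
    · exact ⟨m, by omega, by omega, by rw [h3, h]⟩
    · exact ⟨m + 1, by omega, by omega, by rw [h3, h]; push_cast; ring⟩
    · exact ⟨m - 1, by omega, by omega, by rw [h3, h]; push_cast; ring⟩

/-- Along a walk the retraction moves by at most one position per step, so three steps cannot cover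
four positions on a cycle of length at least eight. -/
theorem IsOuterplanar.length_le_seven (h : G.IsOuterplanar)
    (hdiam : ∀ x y, ∃ p : G.Walk x y, p.length ≤ 3) {n : ℕ} (hn : 3 ≤ n)
    {f : ZMod n → V} (hf : G.IsCycleMap f)
    (hchord : ∀ i j, G.Adj (f i) (f j) → j = i + 1 ∨ i = j + 1) :
    n ≤ 7 ∧ (n = 7 → ∀ y, y ∈ Set.range f) := by
  obtain ⟨r, hrf, hr, hout⟩ := h.exists_retraction hn hf hchord
  have hzero : ∀ m : ℤ, 0 < m → m < n → (m : ZMod n) ≠ 0 := by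
    intro m h0 hm he
    rw [ZMod.intCast_zmod_eq_zero_iff_dvd _ n] at he
    exact absurd (Int.le_of_dvd h0 he) (by omega)
  constructor
  · by_contra! hlt
    obtain ⟨p, hp⟩ := hdiam (f 0) (f 4)
    obtain ⟨m, h1, h2, h3⟩ := p.exists_eq_add_intCast hr
    rw [hrf, hrf] at h3
    refine hzero (4 - m) (by omega) (by omega) ?_
    push_cast
    linear_combination h3
  · rintro rfl y
    by_contra hy
    -- The first step from `y` never moves backwards, so three steps change the position by an
    -- amount between `-2` and `3`, none of which is `4` modulo 7.
    obtain ⟨w, hw⟩ : ∃ w, w = f (r y + 4) := ⟨_, rfl⟩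
    obtain ⟨p, hp⟩ := hdiam y w
    cases p with
    | nil => exact hy (hw ▸ Set.mem_range_self _)
    | cons hyz q =>
      rw [Walk.length_cons] at hp
      obtain ⟨m, h1, h2, h3⟩ := q.exists_eq_add_intCast hr
      rw [hw, hrf] at h3
      rcases hout _ _ hy hyz with h | h <;> rw [h] at h3
      · refine hzero (4 - m) (by omega) (by push_cast; omega) ?_
        push_cast
        linear_combination h3
      · refine hzero (3 - m) (by omega) (by push_cast; omega) ?_
        push_cast
        linear_combination h3

/-! ### Rainbow colourings. -/

/-- `u` and `v` are joined by a walk whose edges have pairwise distinct colours, all in `S`. -/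
def RainbowLinked (G : SimpleGraph V) (c : Sym2 V → ℕ) (S : Set ℕ) (u v : V) : Prop :=
  ∃ p : G.Walk u v, (∀ e ∈ p.edges, c e ∈ S) ∧
    ∀ e ∈ p.edges, ∀ f ∈ p.edges, c e = c f → e = f

namespace RainbowLinked

variable {c : Sym2 V → ℕ} {S T : Set ℕ} {u v w : V}

theorem refl (c : Sym2 V → ℕ) (S : Set ℕ) (u : V) : G.RainbowLinked c S u u :=
  ⟨Walk.nil, by simp, by simp⟩

theorem mono (hST : S ⊆ T) (h : G.RainbowLinked c S u v) : G.RainbowLinked c T u v := by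
  obtain ⟨p, h1, h2⟩ := h
  exact ⟨p, fun e he => hST (h1 e he), h2⟩

theorem symm (h : G.RainbowLinked c S u v) : G.RainbowLinked c S v u := by
  obtain ⟨p, h1, h2⟩ := h
  exact ⟨p.reverse, by simpa using h1, by simpa using h2⟩

theorem trans (hST : Disjoint S T) (h : G.RainbowLinked c S u v) (h' : G.RainbowLinked c T v w) :
    G.RainbowLinked c (S ∪ T) u w := by
  obtain ⟨p, h1, h2⟩ := h
  obtain ⟨q, h3, h4⟩ := h'
  rw [Set.disjoint_left] at hST
  refine ⟨p.append q, fun e he => ?_, fun e he f hf hef => ?_⟩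
  · rw [Walk.edges_append, List.mem_append] at he
    exact he.imp (h1 e) (h3 e)
  · rw [Walk.edges_append, List.mem_append] at he hf
    rcases he with he | he <;> rcases hf with hf | hf
    · exact h2 e he f hf hef
    · exact absurd (h3 f hf) (hef ▸ hST (h1 e he))
    · exact absurd (h3 e he) (hef ▸ hST (h1 f hf))
    · exact h4 e he f hf hef

theorem of_adj (h : G.Adj u v) (hc : c s(u, v) ∈ S) : G.RainbowLinked c S u v :=
  ⟨h.toWalk, by simpa using hc, by simp⟩

end RainbowLinked

/-- Walks may replace paths in `RainbowLinked`, since bypassing only drops edges. -/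
theorem rainbowConnectionNumber_le {k : ℕ} (c : Sym2 V → ℕ) (hc : ∀ e, c e < k) {S : Set ℕ}
    (h : ∀ u v, G.RainbowLinked c S u v) : G.rainbowConnectionNumber ≤ k := by
  classical
  refine iInf₂_le k ⟨fun e => ⟨c e, hc e⟩, fun u v => ?_⟩
  obtain ⟨p, -, hp⟩ := h u v
  refine ⟨p.bypass, p.bypass_isPath, fun e f he hf hef => Subtype.ext ?_⟩
  exact hp e (p.edges_bypass_subset_edges he) f (p.edges_bypass_subset_edges hf) (Fin.ext_iff.1 hef)

/-- The vertices of any graph can be split into two parts so that every vertex that is not isolated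
has a neighbour in the other part. -/
theorem exists_bipartition (H : SimpleGraph V) :
    ∃ s : V → Prop, ∀ x y, H.Adj x y → ∃ z, H.Adj x z ∧ (s z ↔ ¬ s x) := by
  let root : V → V := fun x => (H.connectedComponentMk x).out
  have hroot : ∀ x, H.Reachable x (root x) := fun x =>
    (ConnectedComponent.exact (Quot.out_eq (H.connectedComponentMk x))).symm
  have hadj : ∀ x y, H.Adj x y → root x = root y := fun x y h => by
    simp only [root, ConnectedComponent.sound h.reachable]
  -- Parity of the distance to a root of the component: a root has neighbours at distance one, any
  -- other vertex has a neighbour one step closer.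
  refine ⟨fun x => Even (H.dist x (root x)), fun x y hxy => ?_⟩
  obtain ⟨p, hp⟩ := (hroot x).exists_walk_length_eq_dist
  rcases Nat.eq_zero_or_pos p.length with h0 | hpos
  · refine ⟨y, hxy, ?_⟩
    have hx : x = root x := Walk.eq_of_length_eq_zero h0
    have h1 : H.dist y (root y) = 1 := by
      rw [← hadj x y hxy, ← hx]
      exact dist_eq_one_iff_adj.2 hxy.symm
    beta_reduce
    rw [h1, ← hp, h0]
    simp
  · have key : ∀ (t : V) (p : H.Walk x t), 0 < p.length → p.length = H.dist x t →
        ∃ z, H.Adj x z ∧ H.dist x t = H.dist z t + 1 := by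
      intro t p hpos hp
      cases p with
      | nil => simp at hpos
      | cons hxz q =>
        refine ⟨_, hxz, le_antisymm ?_ ?_⟩
        · obtain ⟨q', hq'⟩ := q.reachable.exists_walk_length_eq_dist
          rw [← hq']
          exact dist_le (Walk.cons hxz q')
        · rw [← hp, Walk.length_cons]
          exact Nat.succ_le_succ (dist_le q)
    obtain ⟨z, hxz, hz⟩ := key _ p hpos hp
    refine ⟨z, hxz, ?_⟩
    beta_reduce
    rw [hz, hadj x z hxz, Nat.even_add_one, not_not]

/-- A rainbow colouring inside a dominating set of a graph with minimum degree at least two extends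
to the whole graph with three additional colours. -/
theorem exists_rainbow_extension {D : Set V} (hD : ∀ x ∉ D, ∃ d ∈ D, G.Adj x d)
    (hdeg : ∀ x, ∃ y z, y ≠ z ∧ G.Adj x y ∧ G.Adj x z) {k : ℕ} {c₀ : Sym2 V → ℕ}
    (hc₀ : ∀ e, c₀ e < k)
    (hlink : ∀ u ∈ D, ∀ v ∈ D, ∃ p : G.Walk u v, (∀ e ∈ p.edges, ∀ x ∈ e, x ∈ D) ∧
      ∀ e ∈ p.edges, ∀ f ∈ p.edges, c₀ e = c₀ f → e = f) :
    ∃ c : Sym2 V → ℕ, (∀ e, c e < k + 3) ∧ ∃ S, ∀ u v, G.RainbowLinked c S u v := by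
  classical
  obtain ⟨s, hs⟩ := exists_bipartition (G.avoid D)
  choose d₁ d₂ hd₁₂ hd₁ hd₂ using hdeg
  let iso : V → Prop := fun x => ∀ y, G.Adj x y → y ∈ D
  -- `Q` selects colour `k` for edges into `D`. A vertex with all neighbours in `D` uses it on one
  -- chosen edge; any other vertex outside `D` uses it on all its edges into `D` or on none,
  -- according to its side of the bipartition.
  let Q : V → Sym2 V → Prop := fun x e => (iso x ∧ e = s(x, d₁ x)) ∨ (¬ iso x ∧ s x)
  let c : Sym2 V → ℕ := fun e =>
    if ∀ x ∈ e, x ∈ D then c₀ e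
    else if ∀ x ∈ e, x ∉ D then k + 2
    else if ∃ x ∈ e, x ∉ D ∧ Q x e then k else k + 1
  have c_in : ∀ e, (∀ x ∈ e, x ∈ D) → c e = c₀ e := fun e he => if_pos he
  have c_out : ∀ x y, x ∉ D → y ∉ D → c s(x, y) = k + 2 := by
    intro x y hx hy
    simp [c, hx, hy]
  have c_mixed : ∀ x y, x ∉ D → y ∈ D → c s(x, y) = if Q x s(x, y) then k else k + 1 := by
    intro x y hx hy
    simp [c, hx, hy]
  let exit : V → Set ℕ → Prop := fun x S => ∃ d ∈ D, G.RainbowLinked c S x d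
  have hexit_mono : ∀ {x S T}, S ⊆ T → exit x S → exit x T :=
    fun hST ⟨d, hd, h⟩ => ⟨d, hd, h.mono hST⟩
  -- The second exit of a vertex that has a neighbour outside `D` goes through a neighbour on the
  -- other side, over an edge of colour `k + 2`.
  have hexit : ∀ x, (exit x {k} ∧ exit x {k + 1, k + 2}) ∨ (exit x {k + 1} ∧ exit x {k, k + 2}) := by
    intro x
    by_cases hx : x ∈ D
    · exact Or.inl ⟨⟨x, hx, RainbowLinked.refl _ _ _⟩, ⟨x, hx, RainbowLinked.refl _ _ _⟩⟩
    by_cases hi : iso x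
    · refine Or.inl ⟨⟨d₁ x, hi _ (hd₁ x), RainbowLinked.of_adj (hd₁ x) ?_⟩,
        ⟨d₂ x, hi _ (hd₂ x), RainbowLinked.of_adj (hd₂ x) ?_⟩⟩
      · rw [c_mixed x _ hx (hi _ (hd₁ x)), if_pos (Or.inl ⟨hi, rfl⟩)]
        rfl
      · rw [c_mixed x _ hx (hi _ (hd₂ x)), if_neg]
        · simp
        · rintro (⟨-, h⟩ | ⟨h, -⟩)
          · exact hd₁₂ x (Sym2.congr_right.1 h).symm
          · exact h hi
    · have hcol : ∀ z, z ∉ D → ¬ iso z → ∀ y ∈ D, c s(z, y) = if s z then k else k + 1 := by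
        intro z hz hzi y hy
        rw [c_mixed z y hz hy]
        simp [Q, hzi]
      obtain ⟨y, hxy, hy⟩ : ∃ y, G.Adj x y ∧ y ∉ D := by simpa [iso] using hi
      obtain ⟨z, ⟨hxz, -, hz⟩, hsz⟩ := hs x y ⟨hxy, hx, hy⟩
      have hzi : ¬ iso z := fun h => hx (h x hxz.symm)
      obtain ⟨d, hd, hxd⟩ := hD x hx
      obtain ⟨d', hd', hzd'⟩ := hD z hz
      have hstep : G.RainbowLinked c {k + 2} x z := RainbowLinked.of_adj hxz (c_out x z hx hz)
      by_cases hsx : s x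
      · refine Or.inl ⟨⟨d, hd, RainbowLinked.of_adj hxd ?_⟩, ⟨d', hd', ?_⟩⟩
        · rw [hcol x hx hi d hd, if_pos hsx]; rfl
        · refine (hstep.trans (T := {k + 1}) (by simp)
            (RainbowLinked.of_adj hzd' ?_)).mono (by simp [Set.pair_comm])
          rw [hcol z hz hzi d' hd', if_neg (fun h => hsz.1 h hsx)]; rfl
      · refine Or.inr ⟨⟨d, hd, RainbowLinked.of_adj hxd ?_⟩, ⟨d', hd', ?_⟩⟩
        · rw [hcol x hx hi d hd, if_neg hsx]; rfl
        · refine (hstep.trans (T := {k}) (by simp)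
            (RainbowLinked.of_adj hzd' ?_)).mono (by simp [Set.pair_comm])
          rw [hcol z hz hzi d' hd', if_pos (hsz.2 hsx)]; rfl
  have hinside : ∀ u ∈ D, ∀ v ∈ D, G.RainbowLinked c (Set.Iio k) u v := by
    intro u hu v hv
    obtain ⟨p, h1, h2⟩ := hlink u hu v hv
    refine ⟨p, fun e he => ?_, fun e he f hf hef => h2 e he f hf ?_⟩
    · rw [c_in e (h1 e he)]; exact hc₀ e
    · rwa [c_in e (h1 e he), c_in f (h1 f hf)] at hef
  have hjoin : ∀ {u v : V} {S T : Set ℕ}, exit u S → exit v T → S ⊆ {k, k + 1, k + 2} →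
      T ⊆ {k, k + 1, k + 2} → Disjoint S T → G.RainbowLinked c Set.univ u v := by
    rintro u v S T ⟨d, hd, hu⟩ ⟨d', hd', hv⟩ hS hT hST
    have hk : ∀ {S : Set ℕ}, S ⊆ {k, k + 1, k + 2} → Disjoint S (Set.Iio k) := fun hS =>
      Set.disjoint_left.2 fun m hm hmk => by
        have := hS hm
        simp only [Set.mem_insert_iff, Set.mem_singleton_iff, Set.mem_Iio] at this hmk
        omega
    exact ((hu.trans (hk hS) (hinside d hd d' hd')).trans
      (Set.disjoint_union_left.2 ⟨hST, (hk hT).symm⟩) hv.symm).mono (Set.subset_univ _)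
  refine ⟨c, fun e => ?_, Set.univ, fun u v => ?_⟩
  · have := hc₀ e
    simp only [c]
    split_ifs <;> omega
  -- Vertices of the same type use different kinds of exit; vertices of different types both use
  -- their direct exits.
  · rcases hexit u with ⟨hu1, hu2⟩ | ⟨hu1, hu2⟩ <;> rcases hexit v with ⟨hv1, hv2⟩ | ⟨hv1, hv2⟩
    · exact hjoin hu1 hv2 (by simp) (by simp) (by simp)
    · exact hjoin hu1 hv1 (by simp) (by simp) (by simp)
    · exact hjoin hu1 hv1 (by simp) (by simp) (by simp)
    · exact hjoin hu1 hv2 (by simp) (by simp [Set.insert_subset_iff]) (by simp)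

theorem mod_ne_mod_of_sub {a b h : ℕ} (hab : a < b) (h2 : b - a < 2 * h) (hne : b - a ≠ h) :
    a % h ≠ b % h := by
  intro he
  obtain ⟨k, hk⟩ := (Nat.modEq_iff_dvd' hab.le).1 he
  rcases k with - | - | k
  · omega
  · omega
  · have : h * 2 ≤ h * (k + 1 + 1) := Nat.mul_le_mul_left h (by omega)
    omega

/-- The edges of a cycle of length `n` can be coloured with `⌈n / 2⌉` colours so that the cycle is
rainbow connected. -/
theorem IsCycleMap.exists_rainbow {n : ℕ} (hn : 3 ≤ n) {f : ZMod n → V} (hf : G.IsCycleMap f) :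
    ∃ c₀ : Sym2 V → ℕ, (∀ e, c₀ e < (n + 1) / 2) ∧ ∀ u ∈ Set.range f, ∀ v ∈ Set.range f,
      ∃ p : G.Walk u v, (∀ e ∈ p.edges, ∀ x ∈ e, x ∈ Set.range f) ∧
        ∀ e ∈ p.edges, ∀ e' ∈ p.edges, c₀ e = c₀ e' → e = e' := by
  classical
  have : NeZero n := ⟨by omega⟩
  have hinj : ∀ i j, s(f i, f (i + 1)) = s(f j, f (j + 1)) → i = j := by
    intro i j hij
    rcases Sym2.eq_iff.1 hij with ⟨h, -⟩ | ⟨h1, h2⟩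
    · exact hf.injective h
    · have h1 := hf.injective h1
      have h2 := hf.injective h2
      exfalso
      have h3 : ((2 : ℕ) : ZMod n) = 0 := by push_cast; linear_combination h2 - h1
      rw [ZMod.natCast_eq_zero_iff] at h3
      exact absurd (Nat.le_of_dvd (by norm_num) h3) (by omega)
  -- The edges of the cycle are numbered around it modulo `⌈n / 2⌉`; other edges get a dummy colour,
  -- as the walks never use them.
  let c₀ : Sym2 V → ℕ := fun e =>
    (if he : ∃ i, e = s(f i, f (i + 1)) then he.choose.val else 0) % ((n + 1) / 2)
  have hc₀ : ∀ i, c₀ s(f i, f (i + 1)) = i.val % ((n + 1) / 2) := by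
    intro i
    have he : ∃ j, s(f i, f (i + 1)) = s(f j, f (j + 1)) := ⟨i, rfl⟩
    simp only [c₀, dif_pos he]
    rw [← hinj _ _ he.choose_spec]
  have hwalk : ∀ (i : ZMod n) (t : ℕ), ∃ p : G.Walk (f i) (f (i + t)),
      ∀ e ∈ p.edges, ∃ s < t, e = s(f (i + (s : ℕ)), f (i + (s : ℕ) + 1)) := by
    intro i t
    induction t with
    | zero => exact ⟨Walk.nil.copy rfl (by simp), by simp⟩
    | succ t ih =>
      obtain ⟨p, hp⟩ := ih
      refine ⟨(p.concat (hf.adj (i + t))).copy rfl (by push_cast; rw [add_assoc]), fun e he => ?_⟩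
      rw [Walk.edges_copy, Walk.edges_concat, List.concat_eq_append, List.mem_append,
        List.mem_singleton] at he
      rcases he with he | rfl
      · obtain ⟨s, hs, rfl⟩ := hp e he
        exact ⟨s, by omega, rfl⟩
      · exact ⟨t, by omega, rfl⟩
  have hval : ∀ (i : ZMod n) (s : ℕ), s < n → (i + s).val = i.val + s ∨
      (i + s).val + n = i.val + s := by
    intro i s hs
    have hi := ZMod.val_lt i
    rw [ZMod.val_add, ZMod.val_cast_of_lt hs]
    rcases Nat.lt_or_ge (i.val + s) n with h | h
    · left; exact Nat.mod_eq_of_lt h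
    · right
      rw [Nat.mod_eq_sub_mod h, Nat.mod_eq_of_lt (by omega)]
      omega
  -- If the arc passes position 0, the numbers differ by `n - (s' - s)`, which lies strictly between
  -- `⌈n / 2⌉` and `2 * ⌈n / 2⌉`.
  have hmod : ∀ (i : ZMod n) (s s' : ℕ), s < s' → s' < n / 2 →
      (i + s).val % ((n + 1) / 2) ≠ (i + s').val % ((n + 1) / 2) := by
    intro i s s' hss hs'
    have hi := ZMod.val_lt (i + (s' : ZMod n))
    rcases hval i s (by omega) with h1 | h1 <;> rcases hval i s' (by omega) with h2 | h2
    · exact mod_ne_mod_of_sub (by omega) (by omega) (by omega)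
    · exact (mod_ne_mod_of_sub (by omega) (by omega) (by omega)).symm
    · omega
    · exact mod_ne_mod_of_sub (by omega) (by omega) (by omega)
  have hshort : ∀ (i : ZMod n) (t : ℕ), t ≤ n / 2 → ∃ p : G.Walk (f i) (f (i + t)),
      (∀ e ∈ p.edges, ∀ x ∈ e, x ∈ Set.range f) ∧
        ∀ e ∈ p.edges, ∀ e' ∈ p.edges, c₀ e = c₀ e' → e = e' := by
    intro i t ht
    obtain ⟨p, hp⟩ := hwalk i t
    refine ⟨p, fun e he x hx => ?_, fun e he e' he' hee => ?_⟩
    · obtain ⟨s, -, rfl⟩ := hp e he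
      rcases Sym2.mem_iff.1 hx with rfl | rfl <;> exact Set.mem_range_self _
    · obtain ⟨s, hs, rfl⟩ := hp e he
      obtain ⟨s', hs', rfl⟩ := hp e' he'
      rw [hc₀, hc₀] at hee
      rcases lt_trichotomy s s' with hlt | rfl | hlt
      · exact absurd hee (hmod i s s' hlt (by omega))
      · rfl
      · exact absurd hee.symm (hmod i s' s hlt (by omega))
  refine ⟨c₀, fun e => Nat.mod_lt _ (by omega), ?_⟩
  rintro _ ⟨i, rfl⟩ _ ⟨j, rfl⟩
  obtain ⟨t, ht, htn⟩ : ∃ t : ℕ, (t : ZMod n) = j - i ∧ t < n :=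
    ⟨(j - i).val, ZMod.natCast_zmod_val _, ZMod.val_lt _⟩
  rcases Nat.lt_or_ge (n / 2) t with hlt | hle
  · obtain rfl : i = j + ((n - t : ℕ) : ZMod n) := by
      rw [Nat.cast_sub htn.le, ZMod.natCast_self, ht]
      ring
    obtain ⟨p, h1, h2⟩ := hshort j (n - t) (by omega)
    exact ⟨p.reverse, by simpa using h1, by simpa using h2⟩
  · obtain rfl : j = i + t := by rw [ht]; ring
    exact hshort i t hle

/-! ### The two bounds. -/

theorem exists_walk_length_le_of_ediam_le {k : ℕ} (h : G.ediam ≤ k) (x y : V) :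
    ∃ p : G.Walk x y, p.length ≤ k := by
  have hle : G.edist x y ≤ k := edist_le_ediam.trans h
  obtain ⟨p, hp⟩ := exists_walk_of_edist_ne_top (ne_top_of_le_ne_top (ENat.natCast_ne_top k) hle)
  exact ⟨p, by rw [← hp] at hle; exact_mod_cast hle⟩

/-- After deletion of the edge `x y` there is still a walk from `x` to `y`; its first edge leads to
another neighbour. -/
theorem IsBridgeless.exists_two_adj (h : G.IsBridgeless) {x y : V} (hxy : G.Adj x y) :
    ∃ y z, y ≠ z ∧ G.Adj x y ∧ G.Adj x z := by
  have hb := h s(x, y) hxy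
  rw [isBridge_iff, not_not] at hb
  obtain ⟨p⟩ := hb
  cases p with
  | nil => exact absurd hxy (G.loopless.irrefl _)
  | cons hxz q =>
    rw [deleteEdges_adj] at hxz
    exact ⟨y, _, fun he => hxz.2 (by rw [he]; rfl), hxy, hxz.1⟩

/-- The rainbow connection number is at least the diameter. -/
theorem ediam_le_rainbowConnectionNumber [Finite V] [Nonempty V] :
    G.ediam ≤ G.rainbowConnectionNumber := by
  obtain ⟨u, v, huv⟩ := exists_edist_eq_ediam_of_finite (G := G)
  refine le_iInf₂ fun k ⟨c, hc⟩ => ?_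
  obtain ⟨p, hp, hpc⟩ := hc u v
  rw [← huv]
  refine p.edist_le.trans ?_
  have hmem : ∀ i : Fin p.edges.length, p.edges.get i ∈ G.edgeSet := fun i =>
    p.edges_subset_edgeSet (List.get_mem _ _)
  have hinj : Function.Injective fun i : Fin p.edges.length => c ⟨p.edges.get i, hmem i⟩ := by
    intro i j hij
    have := hpc ⟨_, hmem i⟩ ⟨_, hmem j⟩ (List.get_mem _ _) (List.get_mem _ _) hij
    exact (List.nodup_iff_injective_get.1 hp.isTrail.edges_nodup) (Subtype.ext_iff.1 this)
  have := Fintype.card_le_of_injective _ hinj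
  simp only [Fintype.card_fin, Walk.length_edges] at this
  exact_mod_cast this

theorem rainbowConnectionNumber_le_of_extension {D : Set V} (hD : ∀ x ∉ D, ∃ d ∈ D, G.Adj x d)
    (hdeg : ∀ x, ∃ y z, y ≠ z ∧ G.Adj x y ∧ G.Adj x z) {k m : ℕ} (hkm : k + 3 ≤ m)
    {c₀ : Sym2 V → ℕ} (hc₀ : ∀ e, c₀ e < k)
    (hlink : ∀ u ∈ D, ∀ v ∈ D, ∃ p : G.Walk u v, (∀ e ∈ p.edges, ∀ x ∈ e, x ∈ D) ∧
      ∀ e ∈ p.edges, ∀ f ∈ p.edges, c₀ e = c₀ f → e = f) :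
    G.rainbowConnectionNumber ≤ m := by
  obtain ⟨c, hc, S, hS⟩ := exists_rainbow_extension hD hdeg hc₀ hlink
  exact rainbowConnectionNumber_le c (fun e => (hc e).trans_le hkm) hS

theorem rainbowConnectionNumber_le_six_of_dominating_edge
    (hdeg : ∀ x, ∃ y z, y ≠ z ∧ G.Adj x y ∧ G.Adj x z) {a b : V} (hab : G.Adj a b)
    (hdom : ∀ x, ¬ G.FarFrom a b x) : G.rainbowConnectionNumber ≤ (6 : ℕ) := by
  refine rainbowConnectionNumber_le_of_extension (D := {a, b}) (k := 1) (c₀ := fun _ => 0)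
    (fun x hx => ?_) hdeg (by norm_num) (by simp) ?_
  · simp only [Set.mem_insert_iff, Set.mem_singleton_iff, not_or] at hx
    by_contra! hcon
    exact hdom x ⟨hx.1, hx.2, hcon a (by simp), hcon b (by simp)⟩
  · rintro u (rfl | rfl) v (rfl | rfl)
    · exact ⟨Walk.nil, by simp, by simp⟩
    · exact ⟨hab.toWalk, by simp, by simp⟩
    · exact ⟨hab.symm.toWalk, by simp, by simp⟩
    · exact ⟨Walk.nil, by simp, by simp⟩

theorem IsOuterplanar.rainbowConnectionNumber_le_six [Finite V] (h : G.IsOuterplanar)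
    (hbridgeless : G.IsBridgeless) (hdiam : ∀ x y, ∃ p : G.Walk x y, p.length ≤ 3)
    (hnontrivial : Nontrivial V) : G.rainbowConnectionNumber ≤ (6 : ℕ) := by
  have hnbr : ∀ x, ∃ y, G.Adj x y := by
    intro x
    obtain ⟨w, hw⟩ := exists_ne x
    obtain ⟨p, -⟩ := hdiam x w
    cases p with
    | nil => exact absurd rfl hw
    | cons hxz q => exact ⟨_, hxz⟩
  have hdeg : ∀ x, ∃ y z, y ≠ z ∧ G.Adj x y ∧ G.Adj x z := fun x =>
    (hnbr x).elim fun _ hy => hbridgeless.exists_two_adj hy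
  by_cases hno : ∀ a b, G.Adj a b → ∃ x, G.FarFrom a b x
  · obtain ⟨x⟩ := hnontrivial.to_nonempty
    obtain ⟨n, f, hn, hf, hchord, hdom⟩ :=
      h.exists_dominating_cycle hdiam ((hnbr x).elim fun y hy => ⟨x, y, hy⟩) hno
    obtain ⟨c₀, hc₀, hlink⟩ := hf.exists_rainbow hn
    obtain ⟨hn7, hspan⟩ := h.length_le_seven hdiam hn hf hchord
    -- For `n = 7` the cycle needs four colours, and three more would be too many; but then the
    -- cycle contains all vertices.
    rcases hn7.lt_or_eq with hlt | heq
    · refine rainbowConnectionNumber_le_of_extension (fun x hx => ?_) hdeg (by omega) hc₀ hlink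
      obtain ⟨i, hi⟩ := hdom x hx
      exact ⟨f i, Set.mem_range_self i, hi⟩
    · refine rainbowConnectionNumber_le c₀ (fun e => (hc₀ e).trans_le (by omega))
        (S := Set.univ) fun u v => ?_
      obtain ⟨p, -, hp⟩ := hlink u (hspan heq u) v (hspan heq v)
      exact ⟨p, fun _ _ => Set.mem_univ _, hp⟩
  · push Not at hno
    obtain ⟨a, b, hab, hdom⟩ := hno
    exact rainbowConnectionNumber_le_six_of_dominating_edge hdeg hab hdom

end SimpleGraph

theorem mainTheorem5 {V : Type*} [Finite V] (G : SimpleGraph V)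
    (hbridgeless : G.IsBridgeless) (houterplanar : G.IsOuterplanar) (hdiam : G.ediam = 3) :
    3 ≤ G.rainbowConnectionNumber ∧ G.rainbowConnectionNumber ≤ 6 := by
  have hnontrivial : Nontrivial V := by
    by_contra hcon
    rw [not_nontrivial_iff_subsingleton] at hcon
    rw [SimpleGraph.ediam_eq_zero_of_subsingleton] at hdiam
    simp at hdiam
  refine ⟨?_, ?_⟩
  · rw [← hdiam]
    exact SimpleGraph.ediam_le_rainbowConnectionNumber
  · exact_mod_cast houterplanar.rainbowConnectionNumber_le_six hbridgeless
      (SimpleGraph.exists_walk_length_le_of_ediam_le (k := 3) hdiam.le) hnontrivial
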